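/- **Theorem 7.1 (null shell equations).** Let $N$ be a smooth manifold of dimension $m\ge 2$ (Hausdorff, second countable, without boundary). *Null metric hypersurface data* on $N$ are a smooth symmetric $(0,2)$-tensor $\gamma$ with one-dimensional radical at every point, a smooth covector field $\ell$ and a smooth function $\ell^{(2)}$ such that the symmetric form $\mathcal A((X_1,a_1),(X_2,a_2))=\gamma(X_1,X_2)+a_1\ell(X_2)+a_2\ell(X_1)+a_1a_2\ell^{(2)}$ on $T_xN\oplus\mathbb R$ is nondegenerate for every $x$. The inverse form $\mathcal A^\sharp$ defines a vector field $n$ and a symmetric $(2,0)$-tensor $P$ by $n(\omega)=\mathcal A^\sharp((\omega,0),(0,1))$ and $P(\omega_1,\omega_2)=\mathcal A^\sharp((\omega_1,0),(\omega_2,0))$; equivalently $\gamma_{ab}n^b=0$, $\ell_an^a=1$, $P^{ab}\ell_b+\ell^{(2)}n^a=0$, $P^{ab}\gamma_{bc}+n^a\ell_c=\delta^a_c$. *Null hypersurface data* contain in addition a smooth symmetric $(0,2)$-tensor $Y$. A *null shell* is a pair of null hypersurface data $(\gamma,\ell,\ell^{(2)},Y^\pm)$ with the same metric part, together with a sign $\varepsilon=\pm1$.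 Notation. Round brackets on indices denote symmetrization with factor $\tfrac12$, and $A\otimes_sB=\tfrac12(A\otimes B+B\otimes A)$. Put $\mathrm{tr}_PT=P^{ab}T_{ab}$, $U=\tfrac12\mathcal L_n\gamma$, $F=\tfrac12d\ell$, $s=F(n,\cdot)$, $Df=df-n(f)\ell$ for functions $f$, and $\widehat X=\gamma(X,\cdot)$, $\underline X=X-\ell(X)n$ for vectors $X$. Let $\overset\circ\nabla$ be the unique torsion-free connection with $$(\overset\circ\nabla_X\gamma)(Z,W)=-U(X,Z)\ell(W)-U(X,W)\ell(Z),\qquad(\overset\circ\nabla_X\ell)(Z)+(\overset\circ\nabla_Z\ell)(X)=-2\ell^{(2)}U(X,Z),$$ and let $\overset\circ R_{ab}$ be its Ricci tensor, where $\overset\circ R(X,W)$ is the trace of $Z\mapsto\overset\circ\nabla_Z\overset\circ\nabla_WX-\overset\circ\nabla_W\overset\circ\nabla_ZX-\overset\circ\nabla_{[Z,W]}X$. For a symmetric $(0,2)$-tensor $T$ let $Q_T=T(n,n)$, $\overline T^a=P^{ab}T_{bc}n^c-\tfrac12(\mathrm{tr}_PT)n^a$, $\mathcal C=\ell\otimes\ell+\tfrac{\ell^{(2)}}{m-1}\gamma$,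 and $$\mathbb P(T)=2\ell\otimes_s\widehat{\overline T}+Q_T\,\mathcal C+\tfrac{\mathrm{tr}_PT}{m-1}\gamma,\qquad T^H=T-\mathbb P(T),$$ $$\overline{\mathcal L}_nT_{ab}=\mathcal L_nT_{ab}-2P^{cd}T_{c(a}U_{b)d}-4\widehat{\overline T}_{(a}s_{b)}-\tfrac{Q_T}{m-1}n(\ell^{(2)})\gamma_{ab},$$ and for a covector field $\omega$ with $\omega(n)=0$ let $$\mathcal O(\omega)_{ab}=2\overset\circ\nabla_{(a}\omega_{b)}-2\ell_{(a}\big(\mathcal L_n\omega_{b)}-2U_{b)f}P^{fc}\omega_c\big)-\tfrac{2}{m-1}P^{cf}\overset\circ\nabla_c\omega_f\,\gamma_{ab}.$$ With $r=Y(n,\cdot)$ and $\kappa_n=-Y(n,n)$, the *constraint tensor* is $$\mathcal R_{ab}=\overset\circ R_{(ab)}-2\mathcal L_nY_{ab}-(2\kappa_n+\mathrm{tr}_PU)Y_{ab}+\overset\circ\nabla_{(a}(s_{b)}+2r_{b)})-2r_ar_b+4r_{(a}s_{b)}-s_as_b-(\mathrm{tr}_PY)U_{ab}+2P^{cd}U_{d(a}(2Y_{b)c}+F_{b)c}),$$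 and its irreducible parts are $\rho=\mathcal R(n,n)$, $\mathfrak p=\mathrm{tr}_P\mathcal R$, $\mathfrak J=\mathcal R(n,\cdot)-\rho\,\ell$ and $\mathcal R^H=\mathcal R-\mathbb P(\mathcal R)$. For a quantity $A^\pm$ computed from the data with $Y^\pm$ let $[A]=A^+-A^-$ and $\langle A\rangle=\tfrac12(A^++A^-)$. The energy density, pressure, transverse energy flux and impulsive gravitational wave of the shell are $$\mu=-\varepsilon[\mathrm{tr}_PY],\qquad p=\varepsilon[\kappa_n],\qquad J=\varepsilon[\underline{\overline Y}],\qquad\Upsilon=\varepsilon[Y^H].$$ Then the following equations hold on $N$: $$\begin{aligned} \varepsilon[\rho]&=p\,\mathrm{tr}_PU,\\ \varepsilon[\mathfrak J]&=-\mathcal L_n\widehat J-(\mathrm{tr}_PU)\widehat J-Dp+2p\,s,\\ \varepsilon[\mathfrak p]&=2n(\ell^{(2)}p+\mu)+2\,\mathrm{tr}_P\big(\overset\circ\nabla\widehat J-2\langle\widehat{\overline Y}\rangle\otimes_s\widehat J-2\widehat J\otimes_ss\big)+4\ell^{(2)}\langle\kappa_n\rangle p+2\langle\kappa_n\rangle\mu-2\langle\mathrm{tr}_PY\rangle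 p+2(\mathrm{tr}_PU)(\ell^{(2)}p+\mu),\\ \varepsilon[\mathcal R^H]&=-2\overline{\mathcal L}_n\Upsilon+\mathcal O(\widehat J)-4\big(\langle\widehat{\overline Y}\rangle\otimes_s\widehat J\big)^H-4\big(s\otimes_s\widehat J\big)^H-2\langle\kappa_n\rangle\Upsilon-2p\langle Y^H\rangle-(\mathrm{tr}_PU)\Upsilon+(\mu+2\ell^{(2)}p)U^H. \end{aligned}$$ -/

import Mathlib

open scoped Manifold ContDiff

noncomputable section

namespace NullShells

/-! ### Pointwise linear algebra -/

section Algebra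

variable {V : Type*} [AddCommGroup V] [Module ℝ V] [TopologicalSpace V]

/-- The symmetric bilinear form
`𝒜((X₁, a₁), (X₂, a₂)) = γ(X₁, X₂) + a₁ ℓ(X₂) + a₂ ℓ(X₁) + a₁ a₂ ℓ⁽²⁾` on `V × ℝ`. -/
def ambientForm (γ : V →L[ℝ] V →L[ℝ] ℝ) (l : V →L[ℝ] ℝ) (l2 : ℝ) :
    LinearMap.BilinForm ℝ (V × ℝ) :=
  LinearMap.mk₂ ℝ (fun u v => γ u.1 v.1 + u.2 * l v.1 + v.2 * l u.1 + u.2 * v.2 * l2)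
    (by intro u u' v; simp; ring) (by intro c u v; simp; ring)
    (by intro u v v'; simp; ring) (by intro c u v; simp; ring)

end Algebra

/-! ### Fields on a smooth manifold of dimension `m` -/

section Fields

variable (m : ℕ) (N : Type*) [TopologicalSpace N] [ChartedSpace (EuclideanSpace ℝ (Fin m)) N]

/-- Vector fields on `N`. -/
abbrev VField := ∀ x : N, TangentSpace (𝓡 m) x

/-- Covector fields on `N`, recorded by their values on tangent vectors. All the fields of this
kind that occur below are linear. -/
abbrev Covec := ∀ x : N, TangentSpace (𝓡 m) x → ℝ

/-- `(0,2)`-tensor fields on `N`, recorded by their values on pairs of tangent vectors. All the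
fields of this kind that occur below are bilinear. -/
abbrev Cov2 := ∀ x : N, TangentSpace (𝓡 m) x → TangentSpace (𝓡 m) x → ℝ

/-- Smoothness of a `(0,2)`-tensor field, as a section of the bundle of bilinear forms. -/
def IsSmoothTwo [IsManifold (𝓡 m) ∞ N]
    (T : ∀ x : N, TangentSpace (𝓡 m) x →L[ℝ] TangentSpace (𝓡 m) x →L[ℝ] ℝ) : Prop :=
  ContMDiff (𝓡 m)
    ((𝓡 m).prod 𝓘(ℝ, EuclideanSpace ℝ (Fin m) →L[ℝ] EuclideanSpace ℝ (Fin m) →L[ℝ] ℝ)) ∞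
    (fun x => Bundle.TotalSpace.mk'
      (EuclideanSpace ℝ (Fin m) →L[ℝ] EuclideanSpace ℝ (Fin m) →L[ℝ] ℝ)
      (E := fun x : N => TangentSpace (𝓡 m) x →L[ℝ] TangentSpace (𝓡 m) x →L[ℝ] ℝ) x (T x))

/-- Smoothness of a covector field, as a section of the cotangent bundle. -/
def IsSmoothOne [IsManifold (𝓡 m) ∞ N] (w : ∀ x : N, TangentSpace (𝓡 m) x →L[ℝ] ℝ) : Prop :=
  ContMDiff (𝓡 m) ((𝓡 m).prod 𝓘(ℝ, EuclideanSpace ℝ (Fin m) →L[ℝ] ℝ)) ∞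
    (fun x => Bundle.TotalSpace.mk' (EuclideanSpace ℝ (Fin m) →L[ℝ] ℝ)
      (E := fun x : N => TangentSpace (𝓡 m) x →L[ℝ] ℝ) x (w x))

end Fields

section Calculus

variable {m : ℕ} {N : Type*} [TopologicalSpace N] [ChartedSpace (EuclideanSpace ℝ (Fin m)) N]

/-- The derivative `v(f)` of a function in the direction of a tangent vector. -/
def dir (f : N → ℝ) (x : N) (v : TangentSpace (𝓡 m) x) : ℝ := mvfderiv (𝓡 m) f x v

/-- A basis `e₁, …, eₘ` of a tangent space. Only traces, which do not depend on the basis, are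
formed with it. -/
def tanBasis (x : N) : Module.Basis (Fin m) ℝ (TangentSpace (𝓡 m) x) :=
  (EuclideanSpace.basisFun (Fin m) ℝ).toBasis

/-- The symmetrized tensor product `ω₁ ⊗ₛ ω₂ = (ω₁ ⊗ ω₂ + ω₂ ⊗ ω₁) / 2`. -/
def symProd (w₁ w₂ : Covec m N) : Cov2 m N :=
  fun x v w => (1 / 2) * (w₁ x v * w₂ x w + w₂ x v * w₁ x w)

variable [IsManifold (𝓡 m) ∞ N]

/-- A local vector field, smooth near `x`, with the value `v` at `x`. -/
def ext {x : N} (v : TangentSpace (𝓡 m) x) : VField m N :=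
  FiberBundle.extend (EuclideanSpace ℝ (Fin m)) v

/-- The Lie derivative of a covector field,
`(£_X θ)(W) = X(θ(W)) - θ([X, W])`, the vector argument being extended to a vector field. -/
def lieOne (X : VField m N) (θ : Covec m N) : Covec m N := fun x w =>
  dir (fun y => θ y (ext w y)) x (X x) - θ x (VectorField.mlieBracket (𝓡 m) X (ext w) x)

/-- The Lie derivative of a `(0,2)`-tensor field,
`(£_X T)(V, W) = X(T(V, W)) - T([X, V], W) - T(V, [X, W])`. -/
def lieTwo (X : VField m N) (T : Cov2 m N) : Cov2 m N := fun x v w =>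
  dir (fun y => T y (ext v y) (ext w y)) x (X x)
    - T x (VectorField.mlieBracket (𝓡 m) X (ext v) x) w
    - T x v (VectorField.mlieBracket (𝓡 m) X (ext w) x)

/-- The exterior derivative of a covector field,
`dθ(V, W) = V(θ(W)) - W(θ(V)) - θ([V, W])`. -/
def extDer (θ : Covec m N) : Cov2 m N := fun x v w =>
  dir (fun y => θ y (ext w y)) x v - dir (fun y => θ y (ext v y)) x w
    - θ x (VectorField.mlieBracket (𝓡 m) (ext v) (ext w) x)

end Calculus

/-! ### Null metric hypersurface data -/

section Data

variable (m : ℕ) (N : Type*) [TopologicalSpace N] [ChartedSpace (EuclideanSpace ℝ (Fin m)) N]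
  [IsManifold (𝓡 m) ∞ N]

/-- Null metric hypersurface data `{N, γ, ℓ, ℓ⁽²⁾}`. -/
structure NullMetricData where
  γ : ∀ x : N, TangentSpace (𝓡 m) x →L[ℝ] TangentSpace (𝓡 m) x →L[ℝ] ℝ
  γ_smooth : IsSmoothTwo m N γ
  γ_symm : ∀ (x : N) (v w : TangentSpace (𝓡 m) x), γ x v w = γ x w v
  γ_radical : ∀ x : N, Module.finrank ℝ (LinearMap.ker (γ x).toLinearMap) = 1
  ℓ : ∀ x : N, TangentSpace (𝓡 m) x →L[ℝ] ℝ
  ℓ_smooth : IsSmoothOne m N ℓ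
  ℓ₂ : N → ℝ
  ℓ₂_smooth : ContMDiff (𝓡 m) 𝓘(ℝ, ℝ) ∞ ℓ₂
  nondegenerate : ∀ x : N, (ambientForm (γ x) (ℓ x) (ℓ₂ x)).Nondegenerate

/-- Null hypersurface data `{N, γ, ℓ, ℓ⁽²⁾, Y}`. -/
structure NullData extends NullMetricData m N where
  Y : ∀ x : N, TangentSpace (𝓡 m) x →L[ℝ] TangentSpace (𝓡 m) x →L[ℝ] ℝ
  Y_smooth : IsSmoothTwo m N Y
  Y_symm : ∀ (x : N) (v w : TangentSpace (𝓡 m) x), Y x v w = Y x w v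

/-- A null shell: two null hypersurface data `{N, γ, ℓ, ℓ⁽²⁾, Y⁺}`, `{N, γ, ℓ, ℓ⁽²⁾, Y⁻}` with
the same metric part, together with a sign `ε`. -/
structure NullShell extends NullMetricData m N where
  Yp : ∀ x : N, TangentSpace (𝓡 m) x →L[ℝ] TangentSpace (𝓡 m) x →L[ℝ] ℝ
  Yp_smooth : IsSmoothTwo m N Yp
  Yp_symm : ∀ (x : N) (v w : TangentSpace (𝓡 m) x), Yp x v w = Yp x w v
  Ym : ∀ x : N, TangentSpace (𝓡 m) x →L[ℝ] TangentSpace (𝓡 m) x →L[ℝ] ℝ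
  Ym_smooth : IsSmoothTwo m N Ym
  Ym_symm : ∀ (x : N) (v w : TangentSpace (𝓡 m) x), Ym x v w = Ym x w v
  ε : ℝ
  ε_sign : ε = 1 ∨ ε = -1

end Data

variable {m : ℕ} {N : Type*} [TopologicalSpace N] [ChartedSpace (EuclideanSpace ℝ (Fin m)) N]
  [IsManifold (𝓡 m) ∞ N]

namespace NullMetricData

variable (D : NullMetricData m N)

/-- The inverse of `u ↦ 𝒜(u, ·)`, from covectors on `TₓN ⊕ ℝ` to `TₓN ⊕ ℝ`; that is,
the contravariant tensor `𝒜♯`. -/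
def ambientInv (x : N) :
    Module.Dual ℝ (TangentSpace (𝓡 m) x × ℝ) →ₗ[ℝ] TangentSpace (𝓡 m) x × ℝ :=
  haveI : FiniteDimensional ℝ (TangentSpace (𝓡 m) x) :=
    inferInstanceAs (FiniteDimensional ℝ (EuclideanSpace ℝ (Fin m)))
  ((ambientForm (D.γ x) (D.ℓ x) (D.ℓ₂ x)).toDual (D.nondegenerate x)).symm.toLinearMap

/-- The vector field `n`, defined by `n(ω) = 𝒜♯((ω, 0), (0, 1))`. -/
def n : VField m N := fun x => (D.ambientInv x (LinearMap.snd ℝ _ ℝ)).1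

/-- The `(2,0)`-tensor field `P(ω₁, ω₂) = 𝒜♯((ω₁, 0), (ω₂, 0))`, as the map `ω ↦ P(ω, ·)` from
covectors to vectors. -/
def P (x : N) : Module.Dual ℝ (TangentSpace (𝓡 m) x) →ₗ[ℝ] TangentSpace (𝓡 m) x :=
  (LinearMap.fst ℝ _ ℝ) ∘ₗ (D.ambientInv x) ∘ₗ (LinearMap.fst ℝ _ ℝ).dualMap

/-- The vector `P(eⁱ, ·) = Pⁱʲ eⱼ`, with `eⁱ` the dual basis. -/
def Pvec (x : N) (i : Fin m) : TangentSpace (𝓡 m) x := D.P x ((tanBasis x).coord i)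

/-- The trace `tr_P T = P^{ab} T_{ab}`. -/
def trP (T : Cov2 m N) : N → ℝ := fun x => ∑ i, T x (D.Pvec x i) (tanBasis x i)

/-- The vector `P^{ab} θ_b`. -/
def raise (θ : Covec m N) : VField m N := fun x => ∑ i, θ x (tanBasis x i) • D.Pvec x i

/-- The contraction `P^{cd} S_{ac} T_{db}`. -/
def contr (S T : Cov2 m N) : Cov2 m N := fun x v w =>
  ∑ i, S x v (D.Pvec x i) * T x (tanBasis x i) w

/-- `γ` as an element of `Cov2`. -/
def γt : Cov2 m N := fun x v w => D.γ x v w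

/-- `ℓ` as an element of `Covec`. -/
def ℓt : Covec m N := fun x v => D.ℓ x v

/-- `U = £_n γ / 2`. -/
def U : Cov2 m N := (1 / 2 : ℝ) • lieTwo D.n D.γt

/-- `F = dℓ / 2`. -/
def F : Cov2 m N := (1 / 2 : ℝ) • extDer D.ℓt

/-- `s = ι_n F`. -/
def s : Covec m N := fun x v => D.F x (D.n x) v

/-- The Koszul expression of `γ`: `X(γ(Z, W)) + Z(γ(X, W)) - W(γ(X, Z)) + γ([X, Z], W)
- γ([X, W], Z) - γ([Z, W], X)`. -/
def koszul (X Z W : VField m N) (x : N) : ℝ :=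
  dir (fun y => D.γ y (Z y) (W y)) x (X x) + dir (fun y => D.γ y (X y) (W y)) x (Z x)
    - dir (fun y => D.γ y (X y) (Z y)) x (W x)
    + D.γ x (VectorField.mlieBracket (𝓡 m) X Z x) (W x)
    - D.γ x (VectorField.mlieBracket (𝓡 m) X W x) (Z x)
    - D.γ x (VectorField.mlieBracket (𝓡 m) Z W x) (X x)

/-- The metric hypersurface connection: `D.nabla Z x v` is `∇°_v Z` at `x`. It is the unique
torsion-free connection with
`(∇°_X γ)(Z, W) = - U(X, Z) ℓ(W) - U(X, W) ℓ(Z)` and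
`(∇°_X ℓ)(Z) + (∇°_Z ℓ)(X) = - 2 ℓ⁽²⁾ U(X, Z)`. By the usual Koszul argument these conditions say
`γ(∇°_X Z, W) = koszul(X, Z, W) / 2 + U(X, Z) ℓ(W)` and
`ℓ(∇°_X Z) = (X(ℓ(Z)) + Z(ℓ(X)) + ℓ([X, Z])) / 2 + ℓ⁽²⁾ U(X, Z)`. As `P^{ab} γ_{bc} + n^a ℓ_c`
is the identity and `P^{ab} ℓ_b = - ℓ⁽²⁾ n^a`, the terms with `U` cancel in
`∇°_X Z = P(γ(∇°_X Z, ·), ·) + ℓ(∇°_X Z) n`, which leaves the expression below. In coordinates,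
`Γ^d_{ab} = P^{dc} (∂_a γ_{bc} + ∂_b γ_{ac} - ∂_c γ_{ab}) / 2 + n^d (∂_a ℓ_b + ∂_b ℓ_a) / 2`. -/
def nabla (Z : VField m N) : ∀ x : N, TangentSpace (𝓡 m) x → TangentSpace (𝓡 m) x :=
  fun x v =>
    (∑ i, ((1 / 2) * D.koszul (ext v) Z (ext (tanBasis x i)) x) • D.Pvec x i)
      + ((1 / 2) * (dir (fun y => D.ℓ y (Z y)) x v + dir (fun y => D.ℓ y (ext v y)) x (Z x)
          + D.ℓ x (VectorField.mlieBracket (𝓡 m) (ext v) Z x))) • D.n x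

/-- The covariant derivative `∇°_a θ_b` of a covector field: the first argument is the direction
of differentiation. -/
def nablaOne (θ : Covec m N) : Cov2 m N := fun x v w =>
  dir (fun y => θ y (ext w y)) x v - θ x (D.nabla (ext w) x v)

/-- `∇°_Z ∇°_W X - ∇°_W ∇°_Z X - ∇°_{[Z, W]} X`. -/
def curvature (Z W X : VField m N) : VField m N := fun x =>
  D.nabla (fun y => D.nabla X y (W y)) x (Z x) - D.nabla (fun y => D.nabla X y (Z y)) x (W x)
    - D.nabla X x (VectorField.mlieBracket (𝓡 m) Z W x)

/-- The Ricci tensor of `∇°`: `Ric(X, W)` is the trace of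
`Z ↦ ∇°_Z ∇°_W X - ∇°_W ∇°_Z X - ∇°_{[Z, W]} X`. -/
def ricci : Cov2 m N := fun x v w =>
  ∑ i, (tanBasis x).coord i (D.curvature (ext (tanBasis x i)) (ext w) (ext v) x)

/-- `D f = df - n(f) ℓ`. -/
def DD (f : N → ℝ) : Covec m N := fun x v => dir f x v - dir f x (D.n x) * D.ℓ x v

/-! ### Decomposition of symmetric `(0,2)`-tensors -/

/-- `Q_T = T(n, n)`. -/
def Q (T : Cov2 m N) : N → ℝ := fun x => T x (D.n x) (D.n x)

/-- `ι_n T = T(n, ·)`. -/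
def iota (T : Cov2 m N) : Covec m N := fun x v => T x (D.n x) v

/-- The vector `T̄^a = P^{ab} (ι_n T)_b - (tr_P T) n^a / 2`. -/
def bar (T : Cov2 m N) : VField m N := fun x =>
  D.raise (D.iota T) x - ((1 / 2) * D.trP T x) • D.n x

/-- The covector `X̂ = γ(X, ·)`. -/
def hat (X : VField m N) : Covec m N := fun x v => D.γ x (X x) v

/-- The vector `X̲ = X - ℓ(X) n`. -/
def und (X : VField m N) : VField m N := fun x => X x - D.ℓ x (X x) • D.n x

/-- The tensor `𝒞 = ℓ ⊗ ℓ + ℓ⁽²⁾ γ / (m - 1)`. -/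
def C : Cov2 m N := fun x v w =>
  D.ℓ x v * D.ℓ x w + D.ℓ₂ x / ((m : ℝ) - 1) * D.γ x v w

/-- The projector `ℙ(T) = 2 ℓ ⊗ₛ T̄̂ + Q_T 𝒞 + (tr_P T) γ / (m - 1)`. -/
def proj (T : Cov2 m N) : Cov2 m N := fun x v w =>
  2 * symProd D.ℓt (D.hat (D.bar T)) x v w + D.Q T x * D.C x v w
    + D.trP T x / ((m : ℝ) - 1) * D.γ x v w

/-- `T^H = T - ℙ(T)`. -/
def H (T : Cov2 m N) : Cov2 m N := T - D.proj T

/-- The linear map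
`𝔅(T)_{ab} = - 2 P^{cd} T_{c(a} U_{b)d} - 4 T̄̂_{(a} s_{b)} - Q_T n(ℓ⁽²⁾) γ_{ab} / (m - 1)`. -/
def frakB (T : Cov2 m N) : Cov2 m N := fun x v w =>
  - (D.contr T D.U x v w + D.contr T D.U x w v)
    - 4 * symProd (D.hat (D.bar T)) D.s x v w
    - D.Q T x / ((m : ℝ) - 1) * dir D.ℓ₂ x (D.n x) * D.γ x v w

/-- The operator `£̄_n T = £_n T + 𝔅(T)`. -/
def lieBar (T : Cov2 m N) : Cov2 m N := lieTwo D.n T + D.frakB T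

/-- The operator
`𝒪(θ)_{ab} = ∇°_a θ_b + ∇°_b θ_a - 2 ℓ_{(a} (£_n θ_{b)} - 2 U_{b)f} P^{fc} θ_c)
- 2 P^{cf} ∇°_c θ_f γ_{ab} / (m - 1)`. -/
def O (θ : Covec m N) : Cov2 m N := fun x v w =>
  D.nablaOne θ x v w + D.nablaOne θ x w v
    - 2 * symProd D.ℓt (fun y u => lieOne D.n θ y u - 2 * D.U y u (D.raise θ y)) x v w
    - 2 / ((m : ℝ) - 1) * D.trP (D.nablaOne θ) x * D.γ x v w

end NullMetricData

namespace NullData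

variable (A : NullData m N)

/-- `Y` as an element of `Cov2`. -/
def Yt : Cov2 m N := fun x v w => A.Y x v w

/-- `r = ι_n Y`. -/
def r : Covec m N := A.iota A.Yt

/-- `κ_n = - Y(n, n)`. -/
def κ : N → ℝ := fun x => - A.Q A.Yt x

/-- The constraint tensor
`ℛ_{ab} = Ric°_{(ab)} - 2 £_n Y_{ab} - (2 κ_n + tr_P U) Y_{ab} + ∇°_{(a} (s_{b)} + 2 r_{b)})
- 2 r_a r_b + 4 r_{(a} s_{b)} - s_a s_b - (tr_P Y) U_{ab}
+ 2 P^{cd} U_{d(a} (2 Y_{b)c} + F_{b)c})`. -/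
def constraint : Cov2 m N := fun x v w =>
  (1 / 2) * (A.ricci x v w + A.ricci x w v)
    - 2 * lieTwo A.n A.Yt x v w
    - (2 * A.κ x + A.trP A.U x) * A.Y x v w
    + (1 / 2) * (A.nablaOne A.s x v w + A.nablaOne A.s x w v)
    + (A.nablaOne A.r x v w + A.nablaOne A.r x w v)
    - 2 * A.r x v * A.r x w
    + 4 * symProd A.r A.s x v w
    - A.s x v * A.s x w
    - A.trP A.Yt x * A.U x v w
    + (A.contr ((2 : ℝ) • A.Yt + A.F) A.U x w v + A.contr ((2 : ℝ) • A.Yt + A.F) A.U x v w)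

/-- `ρ = ℛ(n, n)`. -/
def ρ : N → ℝ := A.Q A.constraint

/-- `𝔭 = tr_P ℛ`. -/
def pp : N → ℝ := A.trP A.constraint

/-- `𝔍 = ℛ(n, ·) - ρ ℓ`. -/
def JJ : Covec m N := fun x v => A.iota A.constraint x v - A.ρ x * A.ℓ x v

/-- `ℛ^H = (𝕀 - ℙ)(ℛ)`. -/
def RH : Cov2 m N := A.H A.constraint

end NullData

namespace NullShell

variable (S : NullShell m N)

/-- The `+` side of the shell. -/
def plus : NullData m N :=
  { S.toNullMetricData with Y := S.Yp, Y_smooth := S.Yp_smooth, Y_symm := S.Yp_symm }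

/-- The `-` side of the shell. -/
def minus : NullData m N :=
  { S.toNullMetricData with Y := S.Ym, Y_smooth := S.Ym_smooth, Y_symm := S.Ym_symm }

/-- The jump `[T] = T⁺ - T⁻`. -/
def jump {α : Type*} [AddCommGroup α] (T : NullData m N → α) : α := T S.plus - T S.minus

/-- The average `(T⁺ + T⁻) / 2`. -/
def avg {α : Type*} [AddCommGroup α] [Module ℝ α] (T : NullData m N → α) : α :=
  (1 / 2 : ℝ) • (T S.plus + T S.minus)

/-- The energy density `μ = - ε [tr_P Y]`. -/
def μ : N → ℝ := -(S.ε • S.jump fun A => A.trP A.Yt)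

/-- The pressure `p = ε [κ_n]`. -/
def p : N → ℝ := S.ε • S.jump fun A => A.κ

/-- The transverse energy flux `J = ε [Ȳ̲]`. -/
def J : VField m N := S.ε • S.jump fun A => A.und (A.bar A.Yt)

/-- The impulsive gravitational wave `Υ = ε [Y^H]`. -/
def Υ : Cov2 m N := S.ε • S.jump fun A => A.H A.Yt

end NullShell

end NullShells

end

noncomputable section

namespace NullShells

/-!
# The null shell equations

The constraint tensor is a quadratic expression in `Y`, so that its jump is linear in the jump of `Y`
and in its average. Derivatives are computed in the coordinate frame of the chart at a point, the jump
of `Y` is decomposed into pressure, energy, flux and a transverse traceless part, and the irreducible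
parts of the jump of the constraint tensor are read off.
-/

/-! ### Directional derivatives and the coordinate frame around a point -/

section Frame

variable {m : ℕ} {N : Type*} [TopologicalSpace N] [ChartedSpace (EuclideanSpace ℝ (Fin m)) N]

/-! The constraint tensor is a polynomial of degree two in `Y`, with quadratic part `2 Y(n,n) Y - 2
r ⊗ r`. Terms free of `Y` (the Ricci tensor, `s`, `F`) drop out of the jump, so no curvature is ever
computed. The rule `[ab] = [a]⟨b⟩ + ⟨a⟩[b]` makes the rest linear in `T = ε[Y]`, with the average `W
= ⟨Y⟩` in the coefficients: this is `scaledDiff_constraintOf`, with value `constraintJump T W`.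

By `decomposition`, `T = 2 ℓ ⊗ₛ θ - p ℓ ⊗ ℓ - ν γ + Υ`, where `θ = Ĵ` kills `n`, `ν = (ℓ⁽²⁾ p +
μ)/(m - 1)`, and `Υ` is transverse to `n` and `P`-traceless. The operators act on each piece through
`£_n γ = 2U`, `£_n ℓ = 2s`, the symmetrized `∇°ℓ = -ℓ⁽²⁾ U`, and `U(n, ·) = 0`. The result is
`constraintJump_eq`.

The four equations are the irreducible parts of that formula. Contraction with `n` removes `Υ`, and
the terms in `W` cancel (`iota_constraintJump`). The trace (`trP_constraintJump`) needs `tr_P (£_n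
Υ) = 2 P^{ac} P^{bd} Υ_{ab} U_{cd}` (`trAt_lieTwo`), which comes from differentiating `tr_P Υ = 0`
and `Pγ = 1 - n ⊗ ℓ` along `n`. Subtracting the projection leaves the last equation
(`H_constraintJump`).

All derivatives are taken at the centre `x` of a chart, where the extensions `ext v` are
constant-coefficient fields with vanishing mutual brackets. Only first-order differentiability at
such centres is needed. -/

/-- Differentiability of a function at a point. -/
abbrev DiffAt (m : ℕ) {N : Type*} [TopologicalSpace N]
    [ChartedSpace (EuclideanSpace ℝ (Fin m)) N] (f : N → ℝ) (x : N) : Prop :=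
  MDifferentiableAt (𝓡 m) 𝓘(ℝ, ℝ) f x

section Dir

variable {f g : N → ℝ} {x : N} (v : TangentSpace (𝓡 m) x)

theorem dir_add (hf : DiffAt m f x) (hg : DiffAt m g x) :
    dir (fun y => f y + g y) x v = dir f x v + dir g x v := by
  simp [dir, mvfderiv_fun_add hf hg]

theorem dir_sub (hf : DiffAt m f x) (hg : DiffAt m g x) :
    dir (fun y => f y - g y) x v = dir f x v - dir g x v := by
  simp [dir, mvfderiv_fun_sub hf hg]

theorem dir_neg : dir (fun y => - f y) x v = - dir f x v := by
  simp [dir, mvfderiv_fun_neg]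

theorem dir_mul (hf : DiffAt m f x) (hg : DiffAt m g x) :
    dir (fun y => f y * g y) x v = dir f x v * g x + f x * dir g x v := by
  simp [dir, mvfderiv_fun_mul hf hg]; ring

theorem dir_const (c : ℝ) : dir (fun _ : N => c) x v = 0 := by
  simp [dir, mvfderiv_const]

theorem diffAt_const (c : ℝ) (x : N) : DiffAt m (fun _ : N => c) x := mdifferentiableAt_const

theorem dir_const_mul (c : ℝ) (hf : DiffAt m f x) :
    dir (fun y => c * f y) x v = c * dir f x v := by
  rw [dir_mul v (diffAt_const c x) hf, dir_const]; ring

theorem dir_congr (h : f =ᶠ[nhds x] g) : dir f x v = dir g x v := by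
  have h' := h.mfderiv_eq (I := 𝓡 m) (I' := 𝓘(ℝ, ℝ))
  have h0 := h.self_of_nhds
  simp only [dir, mvfderiv]
  simp only [ContinuousLinearMap.comp_apply]
  show (mfderiv (𝓡 m) 𝓘(ℝ, ℝ) f x v : ℝ) = (mfderiv (𝓡 m) 𝓘(ℝ, ℝ) g x v : ℝ)
  exact congrFun (congrArg DFunLike.coe h') v

theorem DiffAt.add (hf : DiffAt m f x) (hg : DiffAt m g x) : DiffAt m (fun y => f y + g y) x :=
  MDifferentiableAt.add hf hg

theorem DiffAt.sub (hf : DiffAt m f x) (hg : DiffAt m g x) : DiffAt m (fun y => f y - g y) x :=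
  MDifferentiableAt.sub hf hg

theorem DiffAt.neg (hf : DiffAt m f x) : DiffAt m (fun y => - f y) x :=
  MDifferentiableAt.neg hf

theorem DiffAt.mul (hf : DiffAt m f x) (hg : DiffAt m g x) : DiffAt m (fun y => f y * g y) x :=
  MDifferentiableAt.mul hf hg

theorem DiffAt.const_mul (c : ℝ) (hf : DiffAt m f x) : DiffAt m (fun y => c * f y) x :=
  (diffAt_const c x).mul hf

theorem DiffAt.congr (hf : DiffAt m f x) (h : g =ᶠ[nhds x] f) : DiffAt m g x :=
  MDifferentiableAt.congr_of_eventuallyEq hf h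

theorem DiffAt.sum {ι : Type*} (s : Finset ι) {f : ι → N → ℝ} (hf : ∀ i ∈ s, DiffAt m (f i) x) :
    DiffAt m (fun y => ∑ i ∈ s, f i y) x := by
  classical
  induction s using Finset.induction_on with
  | empty => simpa using diffAt_const 0 x
  | insert a s ha ih =>
    simp only [Finset.sum_insert ha]
    exact (hf a (by simp)).add (ih fun i hi => hf i (by simp [hi]))

theorem DiffAt.prod {ι : Type*} (s : Finset ι) {f : ι → N → ℝ} (hf : ∀ i ∈ s, DiffAt m (f i) x) :
    DiffAt m (fun y => ∏ i ∈ s, f i y) x := by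
  classical
  induction s using Finset.induction_on with
  | empty => simpa using diffAt_const 1 x
  | insert a s ha ih =>
    simp only [Finset.prod_insert ha]
    exact (hf a (by simp)).mul (ih fun i hi => hf i (by simp [hi]))

theorem DiffAt.inv (hf : DiffAt m f x) (h0 : f x ≠ 0) : DiffAt m (fun y => (f y)⁻¹) x :=
  (differentiableAt_inv h0).comp_mdifferentiableAt (I := 𝓡 m) (f := f) hf

theorem dir_sum {ι : Type*} (s : Finset ι) {f : ι → N → ℝ} (hf : ∀ i ∈ s, DiffAt m (f i) x) :
    dir (fun y => ∑ i ∈ s, f i y) x v = ∑ i ∈ s, dir (f i) x v := by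
  classical
  induction s using Finset.induction_on with
  | empty => simpa using dir_const v 0
  | insert a s ha ih =>
    simp only [Finset.sum_insert ha]
    rw [dir_add v (hf a (by simp)) (DiffAt.sum s fun i hi => hf i (by simp [hi])),
      ih fun i hi => hf i (by simp [hi])]

theorem dir_vec_add (f : N → ℝ) (v w : TangentSpace (𝓡 m) x) :
    dir f x (v + w) = dir f x v + dir f x w := by simp [dir]

theorem dir_vec_smul (f : N → ℝ) (c : ℝ) (v : TangentSpace (𝓡 m) x) :
    dir f x (c • v) = c * dir f x v := by simp [dir]

end Dir

/-! ### Constant-coefficient extensions and their Lie brackets. -/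

variable [IsManifold (𝓡 m) ∞ N]

/-- The trivialization of the tangent bundle given by the chart at `x`. -/
abbrev triv (x : N) := trivializationAt (EuclideanSpace ℝ (Fin m)) (TangentSpace (𝓡 m)) x

theorem mem_triv (x : N) : x ∈ (triv (m := m) x).baseSet :=
  FiberBundle.mem_baseSet_trivializationAt' x

theorem triv_mem_nhds (x : N) : (triv (m := m) x).baseSet ∈ nhds x :=
  (triv (m := m) x).open_baseSet.mem_nhds (mem_triv x)

/-- The identification of the tangent spaces at `x` and at `y` in the chart at `x`. -/
def transport (x y : N) (hy : y ∈ (triv (m := m) x).baseSet) :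
    TangentSpace (𝓡 m) x ≃ₗ[ℝ] TangentSpace (𝓡 m) y :=
  ((triv x).linearEquivAt ℝ x (mem_triv x)).trans ((triv x).linearEquivAt ℝ y hy).symm

theorem ext_eq_transport {x y : N} (hy : y ∈ (triv (m := m) x).baseSet)
    (v : TangentSpace (𝓡 m) x) : ext v y = transport x y hy v := rfl

theorem ext_self {x : N} (v : TangentSpace (𝓡 m) x) : ext v x = v :=
  FiberBundle.extend_apply_self (EuclideanSpace ℝ (Fin m)) v

theorem mdifferentiableAt_ext {x : N} (v : TangentSpace (𝓡 m) x) :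
    MDifferentiableAt (𝓡 m) ((𝓡 m).prod 𝓘(ℝ, EuclideanSpace ℝ (Fin m)))
      (fun y => (Bundle.TotalSpace.mk' (EuclideanSpace ℝ (Fin m)) y (ext v y) :
        TangentBundle (𝓡 m) N)) x :=
  FiberBundle.mdifferentiableAt_extend (𝓡 m) (EuclideanSpace ℝ (Fin m)) v

/-- The inverse trivialization is the derivative of the inverse chart, so the pullback undoes
exactly what `ext` does, and `ext u` reads as a constant field in the chart. -/
theorem mpullbackWithin_ext {x : N} (u : TangentSpace (𝓡 m) x) {z : EuclideanSpace ℝ (Fin m)}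
    (hz : z ∈ (extChartAt (𝓡 m) x).target) :
    VectorField.mpullbackWithin 𝓘(ℝ, EuclideanSpace ℝ (Fin m)) (𝓡 m) (extChartAt (𝓡 m) x).symm
      (ext u) (Set.range (𝓡 m)) z = (triv x).linearEquivAt ℝ x (mem_triv x) u := by
  have hz' : (extChartAt (𝓡 m) x).symm z ∈ (chartAt (EuclideanSpace ℝ (Fin m)) x).source := by
    have := (extChartAt (𝓡 m) x).map_target hz
    rwa [extChartAt_source] at this
  have h := TangentBundle.symmL_trivializationAt (I := 𝓡 m) hz'
  rw [(extChartAt (𝓡 m) x).right_inv hz] at h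
  have hinv := isInvertible_mfderivWithin_extChartAt_symm (I := 𝓡 m) hz
  have e : ext u ((extChartAt (𝓡 m) x).symm z) =
      mfderivWithin 𝓘(ℝ, EuclideanSpace ℝ (Fin m)) (𝓡 m) (extChartAt (𝓡 m) x).symm
        (Set.range (𝓡 m)) z ((triv x).linearEquivAt ℝ x (mem_triv x) u) := by
    have h' := DFunLike.congr_fun h ((triv x).linearEquivAt ℝ x (mem_triv x) u)
    refine Eq.trans ?_ h'
    exact ((triv x).symmL_apply hz' _).symm
  refine (congrArg _ e).trans ?_
  exact (hinv.inverse_apply_eq).2 rfl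

/-- Both fields are constant in the chart. This removes the bracket terms from `extDer`, `koszul`
and `nabla` when they are evaluated on extensions. -/
theorem mlieBracket_ext_ext {x : N} (v w : TangentSpace (𝓡 m) x) :
    VectorField.mlieBracket (𝓡 m) (ext v) (ext w) x = 0 := by
  have key : ∀ u : TangentSpace (𝓡 m) x,
      VectorField.mpullbackWithin 𝓘(ℝ, EuclideanSpace ℝ (Fin m)) (𝓡 m) (extChartAt (𝓡 m) x).symm
        (ext u) (Set.range (𝓡 m)) =ᶠ[nhdsWithin (extChartAt (𝓡 m) x x)
          ((extChartAt (𝓡 m) x).symm ⁻¹' Set.univ ∩ Set.range (𝓡 m))]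
        fun _ => (triv x).linearEquivAt ℝ x (mem_triv x) u := by
    intro u
    have ht := extChartAt_target_mem_nhdsWithin (I := 𝓡 m) x
    simp only [Set.preimage_univ, Set.univ_inter]
    filter_upwards [ht] with z hz
    exact mpullbackWithin_ext u hz
  have h0 := Filter.EventuallyEq.lieBracketWithin_vectorField_eq_of_mem (𝕜 := ℝ) (key v) (key w)
    (by simp)
  have h1 : VectorField.lieBracketWithin ℝ
      (fun _ : EuclideanSpace ℝ (Fin m) => (triv x).linearEquivAt ℝ x (mem_triv x) v)
      (fun _ => (triv x).linearEquivAt ℝ x (mem_triv x) w)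
      ((extChartAt (𝓡 m) x).symm ⁻¹' Set.univ ∩ Set.range (𝓡 m)) (extChartAt (𝓡 m) x x) = 0 := by
    simp [VectorField.lieBracketWithin]
  have h2 := h0.trans h1
  refine (VectorField.mlieBracketWithin_apply (I := 𝓡 m) (V := ext v) (W := ext w)
    (s := Set.univ) (x₀ := x)).trans ?_
  refine (congrArg _ h2).trans ?_
  exact map_zero _

/-- The frame `∂₁, …, ∂ₘ` of the chart at `x`. -/
def frame (x : N) (i : Fin m) : VField m N := ext (tanBasis x i)

/-- The frame at a point of the chart domain, as a basis. -/
def frameBasis (x y : N) (hy : y ∈ (triv (m := m) x).baseSet) :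
    Module.Basis (Fin m) ℝ (TangentSpace (𝓡 m) y) := (tanBasis x).map (transport x y hy)

theorem frameBasis_apply {x y : N} (hy : y ∈ (triv (m := m) x).baseSet) (i : Fin m) :
    frameBasis x y hy i = frame x i y := by
  simp [frameBasis, frame, ext_eq_transport hy]

open Classical in
/-- The components of a vector field in the chart at `x`. -/
def comp (x : N) (X : VField m N) (i : Fin m) (y : N) : ℝ :=
  if hy : y ∈ (triv (m := m) x).baseSet then (frameBasis x y hy).coord i (X y) else 0

theorem comp_of_mem {x y : N} (hy : y ∈ (triv (m := m) x).baseSet) (X : VField m N) (i : Fin m) :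
    comp x X i y = (frameBasis x y hy).coord i (X y) := by
  rw [comp, dif_pos hy]

theorem sum_comp_smul {x y : N} (hy : y ∈ (triv (m := m) x).baseSet) (X : VField m N) :
    ∑ i, comp x X i y • frame x i y = X y := by
  simp only [comp_of_mem hy, ← frameBasis_apply hy]
  exact (frameBasis x y hy).sum_repr (X y)

theorem frame_self (x : N) (i : Fin m) : frame x i x = tanBasis x i := ext_self _

theorem frameBasis_self (x : N) : frameBasis x x (mem_triv (m := m) x) = tanBasis x := by
  ext i : 1
  rw [frameBasis_apply, frame_self]

theorem comp_self (x : N) (X : VField m N) (i : Fin m) :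
    comp x X i x = (tanBasis x).coord i (X x) := by
  rw [comp_of_mem (mem_triv x), frameBasis_self]

theorem ext_eq_sum {x y : N} (hy : y ∈ (triv (m := m) x).baseSet) (v : TangentSpace (𝓡 m) x) :
    ext v y = ∑ i, (tanBasis x).coord i v • frame x i y := by
  conv_lhs => rw [ext_eq_transport hy, ← (tanBasis x).sum_repr v, map_sum]
  simp [frame, ext_eq_transport hy]

/-- A vector field whose components in charts are differentiable at the centre. -/
def RegVec (X : VField m N) : Prop := ∀ x i, DiffAt m (comp x X i) x

/-- The coordinate derivative `v(Xⁱ) ∂ᵢ` of a vector field. -/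
def coordDer (X : VField m N) {x : N} (v : TangentSpace (𝓡 m) x) : TangentSpace (𝓡 m) x :=
  ∑ i, dir (comp x X i) x v • tanBasis x i

/-- Leibniz rule on `X = Xⁱ ∂ᵢ`: brackets of frame fields vanish, so only `w` acting on the
components survives. -/
theorem mlieBracket_ext {X : VField m N} (hX : RegVec X) {x : N} (w : TangentSpace (𝓡 m) x) :
    VectorField.mlieBracket (𝓡 m) X (ext w) x = - coordDer X w := by
  have h1 : X =ᶠ[nhds x] (∑ i, comp x X i • frame x i : VField m N) := by
    filter_upwards [triv_mem_nhds (m := m) x] with y hy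
    rw [Finset.sum_apply]
    exact (sum_comp_smul hy X).symm
  have hd : ∀ i, MDifferentiableAt (𝓡 m) ((𝓡 m).prod 𝓘(ℝ, EuclideanSpace ℝ (Fin m)))
      (fun y => (Bundle.TotalSpace.mk' (EuclideanSpace ℝ (Fin m)) y
        ((comp x X i • frame x i : VField m N) y) : TangentBundle (𝓡 m) N)) x := fun i =>
    MDifferentiableAt.smul_section (hX x i) (mdifferentiableAt_ext _)
  have key : ∀ s : Finset (Fin m),
      VectorField.mlieBracket (𝓡 m) (∑ i ∈ s, comp x X i • frame x i : VField m N) (ext w) x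
        = - ∑ i ∈ s, dir (comp x X i) x w • tanBasis x i := by
    intro s
    induction s using Finset.induction_on with
    | empty =>
      simp only [Finset.sum_empty, neg_zero]
      exact congrFun VectorField.mlieBracket_zero_left x
    | insert a s ha ih =>
      simp only [Finset.sum_insert ha]
      have hs : MDifferentiableAt (𝓡 m) ((𝓡 m).prod 𝓘(ℝ, EuclideanSpace ℝ (Fin m)))
          (fun y => (Bundle.TotalSpace.mk' (EuclideanSpace ℝ (Fin m)) y
            ((∑ i ∈ s, comp x X i • frame x i : VField m N) y) : TangentBundle (𝓡 m) N)) x := by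
        have := MDifferentiableAt.sum_section (s := s) fun i _ => hd i
        simpa only [Finset.sum_apply] using this
      rw [VectorField.mlieBracket_add_left (hd a) hs, ih,
        VectorField.mlieBracket_smul_left (V := frame x a) (hX x a) (mdifferentiableAt_ext (tanBasis x a))]
      simp only [frame, mlieBracket_ext_ext, ext_self, dir]
      module
  rw [h1.mlieBracket_vectorField_eq (Filter.EventuallyEq.refl _ (ext w)), key]
  rfl

end Frame

variable {m : ℕ} {N : Type*} [TopologicalSpace N] [ChartedSpace (EuclideanSpace ℝ (Fin m)) N]
  [IsManifold (𝓡 m) ∞ N]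

namespace NullMetricData

/-! ### Pointwise algebra of null metric hypersurface data -/

variable (D : NullMetricData m N) {x : N}

theorem ambientForm_ambientInv (φ : Module.Dual ℝ (TangentSpace (𝓡 m) x × ℝ))
    (u : TangentSpace (𝓡 m) x × ℝ) :
    ambientForm (D.γ x) (D.ℓ x) (D.ℓ₂ x) (D.ambientInv x φ) u = φ u := by
  have : FiniteDimensional ℝ (TangentSpace (𝓡 m) x) :=
    inferInstanceAs (FiniteDimensional ℝ (EuclideanSpace ℝ (Fin m)))
  exact LinearMap.BilinForm.apply_toDual_symm_apply (hB := D.nondegenerate x) φ u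

theorem ambientInv_spec (φ : Module.Dual ℝ (TangentSpace (𝓡 m) x × ℝ))
    (v : TangentSpace (𝓡 m) x) (a : ℝ) :
    D.γ x (D.ambientInv x φ).1 v + (D.ambientInv x φ).2 * D.ℓ x v
      + a * D.ℓ x (D.ambientInv x φ).1 + (D.ambientInv x φ).2 * a * D.ℓ₂ x = φ (v, a) := by
  rw [← D.ambientForm_ambientInv φ (v, a)]
  rfl

/-- If `ℓ` also vanished on a generator `k` of the radical, `(k, 0)` would lie in the kernel of the
ambient form. -/
theorem exists_radical : ∃ k : TangentSpace (𝓡 m) x, (∀ v, D.γ x k v = 0) ∧ D.ℓ x k ≠ 0 := by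
  have : FiniteDimensional ℝ (TangentSpace (𝓡 m) x) :=
    inferInstanceAs (FiniteDimensional ℝ (EuclideanSpace ℝ (Fin m)))
  have : Module.Finite ℝ (LinearMap.ker (D.γ x).toLinearMap) :=
    FiniteDimensional.finiteDimensional_submodule _
  obtain ⟨k, hk⟩ := Module.finrank_pos_iff_exists_ne_zero (R := ℝ).1 ((D.γ_radical x).symm ▸ Nat.one_pos)
  have hk0 : ∀ v, D.γ x k v = 0 := fun v => by
    have := LinearMap.mem_ker.1 k.2
    exact DFunLike.congr_fun this v
  refine ⟨k, hk0, fun hl => hk ?_⟩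
  have := (D.nondegenerate x).1 ((k : TangentSpace (𝓡 m) x), (0 : ℝ)) fun u => by
    show D.γ x k u.1 + 0 * D.ℓ x u.1 + u.2 * D.ℓ x k + 0 * u.2 * D.ℓ₂ x = 0
    rw [hk0, hl]; ring
  exact Subtype.ext (congrArg Prod.fst this)

/-- This is the null condition `𝒜♯((0,1),(0,1)) = 0`, seen by testing against the radical vector. It
is why `n` spans the radical of `γ`. -/
theorem ambientInv_snd : (D.ambientInv x (LinearMap.snd ℝ _ ℝ)).2 = 0 := by
  obtain ⟨k, hk, hl⟩ := D.exists_radical (x := x)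
  have h := D.ambientInv_spec (x := x) (LinearMap.snd ℝ _ ℝ) k 0
  rw [D.γ_symm, hk] at h
  simpa [hl] using h

theorem γ_n (v : TangentSpace (𝓡 m) x) : D.γ x (D.n x) v = 0 := by
  have h := D.ambientInv_spec (x := x) (LinearMap.snd ℝ _ ℝ) v 0
  rw [D.ambientInv_snd] at h
  simp only [mul_zero, zero_mul, add_zero, LinearMap.snd_apply] at h
  exact h

theorem γ_n_right (v : TangentSpace (𝓡 m) x) : D.γ x v (D.n x) = 0 := by
  rw [D.γ_symm, γ_n]

theorem ℓ_n : D.ℓ x (D.n x) = 1 := by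
  have h := D.ambientInv_spec (x := x) (LinearMap.snd ℝ _ ℝ) 0 1
  rw [D.ambientInv_snd] at h
  simp only [mul_zero, zero_mul, add_zero, map_zero, one_mul, zero_add, LinearMap.snd_apply] at h
  exact h

section P

variable (α α' : Module.Dual ℝ (TangentSpace (𝓡 m) x))

/-- Testing against `(n, 0)` identifies the scalar component of `𝒜♯(α, 0)` as `α(n)`. The identities
for `γ ∘ P` and `ℓ ∘ P` are the cases `a = 0` and `v = 0`. -/
theorem ambientInv_P (v : TangentSpace (𝓡 m) x) (a : ℝ) :
    D.γ x (D.P x α) v + α (D.n x) * D.ℓ x v + a * D.ℓ x (D.P x α)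
      + α (D.n x) * a * D.ℓ₂ x = α v := by
  have h := fun v a => D.ambientInv_spec (x := x) ((LinearMap.fst ℝ _ ℝ).dualMap α) v a
  have hc := h (D.n x) 0
  rw [D.γ_n_right, D.ℓ_n] at hc
  have hc' : (D.ambientInv x ((LinearMap.fst ℝ _ ℝ).dualMap α)).2 = α (D.n x) := by
    simpa using hc
  have := h v a
  rw [hc'] at this
  exact this

theorem γ_P (v : TangentSpace (𝓡 m) x) :
    D.γ x (D.P x α) v = α v - α (D.n x) * D.ℓ x v := by
  have := D.ambientInv_P α v 0
  linarith

theorem ℓ_P : D.ℓ x (D.P x α) = - D.ℓ₂ x * α (D.n x) := by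
  have := D.ambientInv_P α 0 1
  simp only [map_zero] at this
  linarith

/-- Both pairings equal `γ(Pα, Pα')` up to the correction `-ℓ⁽²⁾ α(n) α'(n)`, which is symmetric. -/
theorem P_symm : α' (D.P x α) = α (D.P x α') := by
  have h1 := D.γ_P α (D.P x α')
  have h2 := D.γ_P α' (D.P x α)
  rw [D.γ_symm] at h2
  rw [D.ℓ_P] at h1 h2
  linarith

omit [IsManifold (𝓡 m) ∞ N] in
theorem dual_ext {v w : TangentSpace (𝓡 m) x}
    (h : ∀ α : Module.Dual ℝ (TangentSpace (𝓡 m) x), α v = α w) : v = w :=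
  (tanBasis x).ext_elem fun i => h ((tanBasis x).coord i)

theorem P_ℓ (α : Module.Dual ℝ (TangentSpace (𝓡 m) x)) (h : ∀ w, α w = D.ℓ x w) :
    D.P x α = - D.ℓ₂ x • D.n x := by
  refine dual_ext fun α' => ?_
  rw [D.P_symm, h, D.ℓ_P]
  simp

end P

/-- Frees contractions with `P` from the chosen basis, since `f = ∑ f(eᵢ) eⁱ`. -/
theorem sum_smul_Pvec {f : TangentSpace (𝓡 m) x → ℝ} (hf : IsLinearMap ℝ f) :
    ∑ i, f (tanBasis x i) • D.Pvec x i = D.P x (hf.mk' f) := by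
  have : hf.mk' f = ∑ i, f (tanBasis x i) • (tanBasis x).coord i := by
    refine (tanBasis x).ext fun j => ?_
    simp [Finsupp.single_apply]
  rw [this, map_sum]
  simp [Pvec]

theorem raise_eq {θ : Covec m N} (hθ : IsLinearMap ℝ (θ x)) : D.raise θ x = D.P x (hθ.mk' _) :=
  D.sum_smul_Pvec hθ

/-- Contraction of a bilinear expression with `P`: `∑ T(P^i, e_i)` for `T = α(·) β(·)`. -/
theorem sum_mul_Pvec {f g : TangentSpace (𝓡 m) x → ℝ} (hf : IsLinearMap ℝ f)
    (hg : IsLinearMap ℝ g) :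
    ∑ i, f (D.Pvec x i) * g (tanBasis x i) = f (D.P x (hg.mk' g)) := by
  rw [← D.sum_smul_Pvec hg]
  have : f (∑ i, g (tanBasis x i) • D.Pvec x i) = (hf.mk' f) (∑ i, g (tanBasis x i) • D.Pvec x i) :=
    rfl
  rw [this, map_sum]
  simp [mul_comm]

/-- The trace `P^{ab} B_{ab}` of a bilinear form at a point. -/
def trAt (x : N) : (TangentSpace (𝓡 m) x → TangentSpace (𝓡 m) x → ℝ) →ₗ[ℝ] ℝ where
  toFun B := ∑ i, B (D.Pvec x i) (tanBasis x i)
  map_add' B B' := by simp [Finset.sum_add_distrib]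
  map_smul' c B := by simp [Finset.mul_sum]

theorem trP_eq (T : Cov2 m N) : D.trP T x = D.trAt x (T x) := rfl

theorem trAt_mul {f g : TangentSpace (𝓡 m) x → ℝ} (hf : IsLinearMap ℝ f)
    (hg : IsLinearMap ℝ g) : D.trAt x (fun v w => f v * g w) = f (D.P x (hg.mk' g)) :=
  D.sum_mul_Pvec hf hg

/-- The trace of `Pγ = 1 - n ⊗ ℓ`, with `ℓ(n) = 1`. -/
theorem trAt_γ : D.trAt x (fun v w => D.γ x v w) = m - 1 := by
  have h : ∀ i, D.γ x (D.Pvec x i) (tanBasis x i)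
      = 1 - D.ℓ x ((tanBasis x).coord i (D.n x) • tanBasis x i) := fun i => by
    rw [Pvec, D.γ_P, map_smul]
    simp
  have h2 : ∑ i, (tanBasis x).coord i (D.n x) • tanBasis x i = D.n x :=
    (tanBasis x).sum_repr (D.n x)
  show ∑ i, D.γ x (D.Pvec x i) (tanBasis x i) = m - 1
  rw [Finset.sum_congr rfl fun i _ => h i, Finset.sum_sub_distrib, ← map_sum, h2, D.ℓ_n]
  simp

theorem ℓ_lin : IsLinearMap ℝ (fun v : TangentSpace (𝓡 m) x => D.ℓ x v) :=
  ⟨map_add _, map_smul _⟩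

theorem γ_lin (w : TangentSpace (𝓡 m) x) :
    IsLinearMap ℝ (fun v : TangentSpace (𝓡 m) x => D.γ x v w) :=
  ⟨fun _ _ => by simp, fun _ _ => by simp⟩

theorem trAt_mul_ℓ {f : TangentSpace (𝓡 m) x → ℝ} (hf : IsLinearMap ℝ f) :
    D.trAt x (fun v w => f v * D.ℓ x w) = - D.ℓ₂ x * f (D.n x) := by
  rw [D.trAt_mul hf D.ℓ_lin, D.P_ℓ (D.ℓ_lin.mk' _) fun w => rfl]
  simpa using hf.map_smul (- D.ℓ₂ x) (D.n x)

theorem trAt_ℓ_mul {f : TangentSpace (𝓡 m) x → ℝ} (hf : IsLinearMap ℝ f) :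
    D.trAt x (fun v w => D.ℓ x v * f w) = - D.ℓ₂ x * f (D.n x) := by
  rw [D.trAt_mul D.ℓ_lin hf, D.ℓ_P]
  rfl

theorem contr_eq {S T : Cov2 m N} (v w : TangentSpace (𝓡 m) x) (hS : IsLinearMap ℝ (S x v))
    (hT : IsLinearMap ℝ fun u => T x u w) :
    D.contr S T x v w = S x v (D.P x (hT.mk' _)) :=
  D.sum_mul_Pvec hS hT

end NullMetricData

/-! ### Regular tensor fields -/

/-- Functions differentiable at every point. -/
def RegFun (m : ℕ) {N : Type*} [TopologicalSpace N] [ChartedSpace (EuclideanSpace ℝ (Fin m)) N]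
    (f : N → ℝ) : Prop := ∀ x, DiffAt m f x

/-- Linear covector fields with components differentiable at the centre of the chart. -/
structure RegOne (θ : Covec m N) : Prop where
  lin : ∀ x, IsLinearMap ℝ (θ x)
  diff : ∀ (x : N) (v : TangentSpace (𝓡 m) x), DiffAt m (fun y => θ y (ext v y)) x

/-- Bilinear `(0,2)`-tensor fields with components differentiable at the centre of the chart. -/
structure RegTwo (T : Cov2 m N) : Prop where
  left : ∀ (x : N) (w : TangentSpace (𝓡 m) x), IsLinearMap ℝ fun v => T x v w
  right : ∀ (x : N) (v : TangentSpace (𝓡 m) x), IsLinearMap ℝ (T x v)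
  diff : ∀ (x : N) (v w : TangentSpace (𝓡 m) x), DiffAt m (fun y => T y (ext v y) (ext w y)) x

theorem IsSmoothOne.regOne {θ : ∀ x : N, TangentSpace (𝓡 m) x →L[ℝ] ℝ} (h : IsSmoothOne m N θ) :
    RegOne (fun x v => θ x v : Covec m N) where
  lin x := ⟨map_add _, map_smul _⟩
  diff x v := by
    have h1 := ((h x).mdifferentiableAt (by simp)).clm_bundle_apply (mdifferentiableAt_ext v)
    rw [mdifferentiableAt_totalSpace] at h1
    exact h1.2

theorem IsSmoothTwo.regTwo
    {T : ∀ x : N, TangentSpace (𝓡 m) x →L[ℝ] TangentSpace (𝓡 m) x →L[ℝ] ℝ}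
    (h : IsSmoothTwo m N T) : RegTwo (fun x v w => T x v w : Cov2 m N) where
  left x w := ⟨fun _ _ => by simp, fun _ _ => by simp⟩
  right x v := ⟨map_add _, map_smul _⟩
  diff x v w := by
    have h1 := ((h x).mdifferentiableAt (by simp)).clm_bundle_apply₂ (mdifferentiableAt_ext v)
      (mdifferentiableAt_ext w)
    rw [mdifferentiableAt_totalSpace] at h1
    exact h1.2

omit [IsManifold (𝓡 m) ∞ N] in
theorem lin_sum {x : N} {f : TangentSpace (𝓡 m) x → ℝ} (hf : IsLinearMap ℝ f) {ι : Type*}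
    (s : Finset ι) (c : ι → ℝ) (v : ι → TangentSpace (𝓡 m) x) :
    f (∑ i ∈ s, c i • v i) = ∑ i ∈ s, c i * f (v i) := by
  refine (map_sum (hf.mk' f) (fun i => c i • v i) s).trans ?_
  exact Finset.sum_congr rfl fun i _ => hf.map_smul _ _

/-! ### Contractions and the chain rule. -/

section Contract

variable {θ : Covec m N} {T : Cov2 m N} {X Z : VField m N}

theorem RegOne.contract_eventually (hθ : RegOne θ) (X : VField m N) (x : N) :
    (fun y => θ y (X y)) =ᶠ[nhds x] fun y => ∑ i, comp x X i y * θ y (frame x i y) := by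
  filter_upwards [triv_mem_nhds (m := m) x] with y hy
  rw [← lin_sum (hθ.lin y), sum_comp_smul hy]

theorem RegOne.contract (hθ : RegOne θ) (hX : RegVec X) : RegFun m fun y => θ y (X y) := fun x =>
  (DiffAt.sum _ fun i _ => (hX x i).mul (hθ.diff x (tanBasis x i))).congr
    (hθ.contract_eventually X x)

/-- The chain rule `v(θ(X)) = v(θᵢ) Xⁱ + θᵢ v(Xⁱ)`. -/
theorem RegOne.dir_contract (hθ : RegOne θ) (hX : RegVec X) {x : N} (v : TangentSpace (𝓡 m) x) :
    dir (fun y => θ y (X y)) x v =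
      dir (fun y => θ y (ext (X x) y)) x v + θ x (coordDer X v) := by
  have h2 : (fun y => θ y (ext (X x) y)) =ᶠ[nhds x]
      fun y => ∑ i, (tanBasis x).coord i (X x) * θ y (frame x i y) := by
    filter_upwards [triv_mem_nhds (m := m) x] with y hy
    rw [← lin_sum (hθ.lin y), ext_eq_sum hy]
  have hd : ∀ i, DiffAt m (fun y => θ y (frame x i y)) x := fun i => hθ.diff x (tanBasis x i)
  rw [dir_congr v (hθ.contract_eventually X x), dir_congr v h2, coordDer, lin_sum (hθ.lin x),
    dir_sum v _ fun i _ => (hX x i).mul (hd i),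
    dir_sum v _ fun i _ => (hd i).const_mul _, ← Finset.sum_add_distrib]
  refine Finset.sum_congr rfl fun i _ => ?_
  rw [dir_mul v (hX x i) (hd i), dir_const_mul v _ (hd i),
    comp_self, frame_self]
  ring

theorem RegTwo.diff_contract (hT : RegTwo T) (hX : RegVec X) {x : N} (w : TangentSpace (𝓡 m) x) :
    DiffAt m (fun y => T y (X y) (ext w y)) x := by
  have h1 : (fun y => T y (X y) (ext w y)) =ᶠ[nhds x]
      fun y => ∑ i, comp x X i y * T y (frame x i y) (ext w y) := by
    filter_upwards [triv_mem_nhds (m := m) x] with y hy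
    rw [← lin_sum (hT.left y _), sum_comp_smul hy]
  exact (DiffAt.sum _ fun i _ => (hX x i).mul (hT.diff x (tanBasis x i) w)).congr h1

/-- The chain rule for the contraction of a `(0,2)`-tensor with a vector field. -/
theorem RegTwo.dir_contract (hT : RegTwo T) (hX : RegVec X) {x : N}
    (v w : TangentSpace (𝓡 m) x) :
    dir (fun y => T y (X y) (ext w y)) x v =
      dir (fun y => T y (ext (X x) y) (ext w y)) x v + T x (coordDer X v) w := by
  have h1 : (fun y => T y (X y) (ext w y)) =ᶠ[nhds x]
      fun y => ∑ i, comp x X i y * T y (frame x i y) (ext w y) := by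
    filter_upwards [triv_mem_nhds (m := m) x] with y hy
    rw [← lin_sum (hT.left y _), sum_comp_smul hy]
  have h2 : (fun y => T y (ext (X x) y) (ext w y)) =ᶠ[nhds x]
      fun y => ∑ i, (tanBasis x).coord i (X x) * T y (frame x i y) (ext w y) := by
    filter_upwards [triv_mem_nhds (m := m) x] with y hy
    rw [← lin_sum (hT.left y _), ext_eq_sum hy]
  have hd : ∀ i, DiffAt m (fun y => T y (frame x i y) (ext w y)) x := fun i =>
    hT.diff x (tanBasis x i) w
  rw [dir_congr v h1, dir_congr v h2, coordDer, lin_sum (hT.left x w),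
    dir_sum v _ fun i _ => (hX x i).mul (hd i),
    dir_sum v _ fun i _ => (hd i).const_mul _, ← Finset.sum_add_distrib]
  refine Finset.sum_congr rfl fun i _ => ?_
  rw [dir_mul v (hX x i) (hd i),
    dir_const_mul v _ (hd i), comp_self, frame_self, ext_self]
  ring

theorem RegTwo.contract (hT : RegTwo T) (hX : RegVec X) :
    RegOne (fun y v => T y (X y) v) where
  lin _ := hT.right _ (X _)
  diff _ w := hT.diff_contract hX w

end Contract

/-! ### Stability of regular tensor fields under algebraic operations. -/

section Closure

variable {f g : N → ℝ} {θ η : Covec m N} {T S : Cov2 m N}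

theorem RegOne.add (h : RegOne θ) (h' : RegOne η) : RegOne (fun x v => θ x v + η x v) where
  lin x := ⟨fun v w => by rw [(h.lin x).map_add, (h'.lin x).map_add]; ring,
    fun c v => by rw [(h.lin x).map_smul, (h'.lin x).map_smul]; simp; ring⟩
  diff x v := (h.diff x v).add (h'.diff x v)

theorem RegOne.smul (hf : RegFun m f) (h : RegOne θ) : RegOne (fun x v => f x * θ x v) where
  lin x := ⟨fun v w => by rw [(h.lin x).map_add]; ring,
    fun c v => by rw [(h.lin x).map_smul]; simp; ring⟩
  diff x v := (hf x).mul (h.diff x v)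

theorem RegTwo.add (h : RegTwo T) (h' : RegTwo S) : RegTwo (fun x v w => T x v w + S x v w) where
  left x w := ⟨fun v v' => by rw [(h.left x w).map_add, (h'.left x w).map_add]; ring,
    fun c v => by rw [(h.left x w).map_smul, (h'.left x w).map_smul]; simp; ring⟩
  right x w := ⟨fun v v' => by rw [(h.right x w).map_add, (h'.right x w).map_add]; ring,
    fun c v => by rw [(h.right x w).map_smul, (h'.right x w).map_smul]; simp; ring⟩
  diff x v w := (h.diff x v w).add (h'.diff x v w)

theorem RegTwo.smul (hf : RegFun m f) (h : RegTwo T) : RegTwo (fun x v w => f x * T x v w) where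
  left x w := ⟨fun v v' => by rw [(h.left x w).map_add]; ring,
    fun c v => by rw [(h.left x w).map_smul]; simp; ring⟩
  right x w := ⟨fun v v' => by rw [(h.right x w).map_add]; ring,
    fun c v => by rw [(h.right x w).map_smul]; simp; ring⟩
  diff x v w := (hf x).mul (h.diff x v w)

theorem RegOne.mul (h : RegOne θ) (h' : RegOne η) : RegTwo (fun x v w => θ x v * η x w) where
  left x w := ⟨fun v v' => by rw [(h.lin x).map_add]; ring,
    fun c v => by rw [(h.lin x).map_smul]; simp; ring⟩
  right x w := ⟨fun v v' => by rw [(h'.lin x).map_add]; ring,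
    fun c v => by rw [(h'.lin x).map_smul]; simp; ring⟩
  diff x v w := (h.diff x v).mul (h'.diff x w)

end Closure

namespace NullMetricData

variable (D : NullMetricData m N)

theorem regTwo_γ : RegTwo D.γt := D.γ_smooth.regTwo

theorem regOne_ℓ : RegOne D.ℓt := D.ℓ_smooth.regOne

theorem regFun_ℓ₂ : RegFun m D.ℓ₂ := fun x =>
  (D.ℓ₂_smooth x).mdifferentiableAt (by simp)

end NullMetricData

/-! ### Differentiability of `n` and `P` through the inverse of the ambient matrix. -/

section MatrixDiff

omit [IsManifold (𝓡 m) ∞ N]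

variable {ι : Type*} [Fintype ι] [DecidableEq ι] {A : N → Matrix ι ι ℝ} {x : N}

theorem DiffAt.det (hA : ∀ i j, DiffAt m (fun y => A y i j) x) :
    DiffAt m (fun y => (A y).det) x := by
  simp only [Matrix.det_apply']
  exact DiffAt.sum _ fun σ _ => DiffAt.const_mul _ (DiffAt.prod _ fun i _ => hA _ _)

/-- Cramer's rule: each entry is a determinant with one row replaced by a constant vector, divided
by the full determinant. -/
theorem DiffAt.matrix_inv (hA : ∀ i j, DiffAt m (fun y => A y i j) x) (h0 : (A x).det ≠ 0)
    (i j : ι) : DiffAt m (fun y => (A y)⁻¹ i j) x := by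
  simp only [Matrix.inv_def, Ring.inverse_eq_inv', Matrix.smul_apply, smul_eq_mul,
    Matrix.adjugate_apply]
  refine (DiffAt.inv (DiffAt.det hA) h0).mul (DiffAt.det fun k l => ?_)
  by_cases hk : k = j
  · subst hk
    simpa using diffAt_const _ x
  · simpa [Matrix.updateRow_ne hk] using hA k l

end MatrixDiff

open Classical in
/-- The coframe dual to the coordinate frame of the chart at `x`. -/
def coframe (x : N) (i : Fin m) (y : N) : Module.Dual ℝ (TangentSpace (𝓡 m) y) :=
  if hy : y ∈ (triv (m := m) x).baseSet then (frameBasis x y hy).coord i else 0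

theorem coframe_of_mem {x y : N} (hy : y ∈ (triv (m := m) x).baseSet) (i : Fin m) :
    coframe x i y = (frameBasis x y hy).coord i := by
  rw [coframe, dif_pos hy]

theorem coframe_self (x : N) (i : Fin m) : coframe x i x = (tanBasis x).coord i := by
  rw [coframe_of_mem (mem_triv x), frameBasis_self]

theorem comp_eq_coframe (x : N) (X : VField m N) (i : Fin m) (y : N) :
    comp x X i y = coframe x i y (X y) := by
  unfold comp coframe
  split <;> rfl

theorem sum_coframe_smul {x y : N} (hy : y ∈ (triv (m := m) x).baseSet)
    (v : TangentSpace (𝓡 m) y) : ∑ i, coframe x i y v • frame x i y = v := by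
  simp only [coframe_of_mem hy, ← frameBasis_apply hy]
  exact (frameBasis x y hy).sum_repr v

theorem coframe_frame {x y : N} (hy : y ∈ (triv (m := m) x).baseSet) (i j : Fin m) :
    coframe x i y (frame x j y) = if i = j then 1 else 0 := by
  simp [coframe_of_mem hy, ← frameBasis_apply hy, Finsupp.single_apply, eq_comm]

namespace NullMetricData

variable (D : NullMetricData m N)

/-- The components `P^{ij}` in the chart at `x`. -/
def PComp (x : N) (i j : Fin m) (y : N) : ℝ := coframe x i y (D.P y (coframe x j y))

theorem PComp_symm (x : N) (i j : Fin m) (y : N) : D.PComp x i j y = D.PComp x j i y :=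
  D.P_symm _ _

theorem sum_PComp_mul {x y : N} (hy : y ∈ (triv (m := m) x).baseSet) {f : TangentSpace (𝓡 m) y → ℝ}
    (hf : IsLinearMap ℝ f) (i : Fin m) :
    ∑ k, D.PComp x i k y * f (frame x k y) = f (D.P y (coframe x i y)) := by
  conv_rhs => rw [← sum_coframe_smul hy (D.P y (coframe x i y)), lin_sum hf]
  exact Finset.sum_congr rfl fun k _ => by rw [D.PComp_symm]; rfl

/-- The matrix of the ambient form in the chart at `x`. -/
def ambientMat (x y : N) : Matrix (Option (Fin m)) (Option (Fin m)) ℝ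
  | some i, some j => D.γ y (frame x i y) (frame x j y)
  | some i, none => D.ℓ y (frame x i y)
  | none, some j => D.ℓ y (frame x j y)
  | none, none => D.ℓ₂ y

/-- The matrix of the inverse of the ambient form in the chart at `x`. -/
def ambientInvMat (x y : N) : Matrix (Option (Fin m)) (Option (Fin m)) ℝ
  | some i, some j => D.PComp x i j y
  | some i, none => coframe x i y (D.n y)
  | none, some j => coframe x j y (D.n y)
  | none, none => 0

theorem sum_PComp_γ {x y : N} (hy : y ∈ (triv (m := m) x).baseSet) (i j : Fin m) :
    ∑ k, D.PComp x i k y * D.γ y (frame x k y) (frame x j y)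
      = (if i = j then 1 else 0) - coframe x i y (D.n y) * D.ℓ y (frame x j y) := by
  rw [D.sum_PComp_mul hy (D.γ_lin _), D.γ_P, coframe_frame hy]

theorem sum_PComp_ℓ {x y : N} (hy : y ∈ (triv (m := m) x).baseSet) (i : Fin m) :
    ∑ k, D.PComp x i k y * D.ℓ y (frame x k y) = - D.ℓ₂ y * coframe x i y (D.n y) := by
  rw [D.sum_PComp_mul hy D.ℓ_lin, D.ℓ_P]

/-- The four blocks are `ℓ(n) = 1`, `γ(n, ·) = 0`, `Pℓ + ℓ⁽²⁾ n = 0` and `Pγ + n ⊗ ℓ = 1`. -/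
theorem ambientInvMat_mul {x y : N} (hy : y ∈ (triv (m := m) x).baseSet) :
    D.ambientInvMat x y * D.ambientMat x y = 1 := by
  have hn : ∀ f : TangentSpace (𝓡 m) y → ℝ, IsLinearMap ℝ f →
      ∑ k, coframe x k y (D.n y) * f (frame x k y) = f (D.n y) := fun f hf => by
    rw [← lin_sum hf, sum_coframe_smul hy]
  ext a b
  rw [Matrix.mul_apply, Fintype.sum_option]
  rcases a with _ | i <;> rcases b with _ | j <;> simp only [ambientInvMat, ambientMat]
  · rw [hn _ D.ℓ_lin, D.ℓ_n]; simp
  · rw [hn _ (D.γ_lin _), D.γ_n, Matrix.one_apply_ne (by simp)]; ring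
  · rw [D.sum_PComp_ℓ hy, Matrix.one_apply_ne (by simp)]; ring
  · rw [D.sum_PComp_γ hy, Matrix.one_apply]; simp

theorem ambientInvMat_eq {x y : N} (hy : y ∈ (triv (m := m) x).baseSet) :
    D.ambientInvMat x y = (D.ambientMat x y)⁻¹ :=
  (Matrix.inv_eq_left_inv (D.ambientInvMat_mul hy)).symm

/-- The fields `n` and `P` are defined pointwise with no smoothness attached; being entries of the
inverse of a differentiable matrix, their components are differentiable. -/
theorem diffAt_ambientInvMat (x : N) (a b : Option (Fin m)) :
    DiffAt m (fun y => D.ambientInvMat x y a b) x := by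
  have h0 : (D.ambientMat x x).det ≠ 0 :=
    (Matrix.isUnit_det_of_left_inverse (D.ambientInvMat_mul (mem_triv x))).ne_zero
  refine (DiffAt.matrix_inv (A := D.ambientMat x) (fun i j => ?_) h0 a b).congr ?_
  · rcases i with _ | i <;> rcases j with _ | j
    · exact D.regFun_ℓ₂ x
    · exact D.regOne_ℓ.diff x (tanBasis x j)
    · exact D.regOne_ℓ.diff x (tanBasis x i)
    · exact D.regTwo_γ.diff x (tanBasis x i) (tanBasis x j)
  · filter_upwards [triv_mem_nhds (m := m) x] with y hy
    rw [D.ambientInvMat_eq hy]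

theorem regVec_n : RegVec D.n := fun x i =>
  (D.diffAt_ambientInvMat x (some i) none).congr (Filter.Eventually.of_forall fun y => by
    rw [comp_eq_coframe]; rfl)

theorem diffAt_PComp (x : N) (i j : Fin m) : DiffAt m (D.PComp x i j) x :=
  D.diffAt_ambientInvMat x (some i) (some j)

/-- The trace `P^{ab} T_{ab}` does not depend on the basis. -/
theorem trP_eq_sum {T : Cov2 m N} (hT : RegTwo T) {x y : N}
    (hy : y ∈ (triv (m := m) x).baseSet) :
    D.trP T y = ∑ i, ∑ j, D.PComp x i j y * T y (frame x i y) (frame x j y) := by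
  have h1 : D.trP T y = ∑ i, ∑ j, coframe x j y (tanBasis y i) * T y (D.Pvec y i) (frame x j y) := by
    refine Finset.sum_congr rfl fun i _ => ?_
    conv_lhs => rw [← sum_coframe_smul hy (tanBasis y i), lin_sum (hT.right y _)]
  rw [h1, Finset.sum_comm, Finset.sum_comm (f := fun i j => D.PComp x i j y * _)]
  refine Finset.sum_congr rfl fun j _ => ?_
  have h2 := D.sum_PComp_mul hy (hT.left y (frame x j y)) j
  simp only [D.PComp_symm x j] at h2
  rw [h2]
  have h3 := D.sum_smul_Pvec (x := y) (f := coframe x j y) (coframe x j y).isLinear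
  have h4 : (coframe x j y).isLinear.mk' _ = coframe x j y := rfl
  rw [h4] at h3
  rw [← h3, lin_sum (hT.left y _)]

theorem regFun_trP {T : Cov2 m N} (hT : RegTwo T) : RegFun m (D.trP T) := fun x => by
  refine DiffAt.congr (DiffAt.sum Finset.univ fun i _ => DiffAt.sum Finset.univ fun j _ =>
    (D.diffAt_PComp x i j).mul (hT.diff x (tanBasis x i) (tanBasis x j))) ?_
  filter_upwards [triv_mem_nhds (m := m) x] with y hy
  exact D.trP_eq_sum hT hy

end NullMetricData

/-! ### Derivatives in the chart at a point -/

theorem coordDer_lin (X : VField m N) (x : N) :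
    IsLinearMap ℝ fun v : TangentSpace (𝓡 m) x => coordDer X v where
  map_add v w := by simp [coordDer, dir_vec_add, add_smul, Finset.sum_add_distrib]
  map_smul c v := by simp [coordDer, dir_vec_smul, mul_smul, Finset.smul_sum]

theorem ext_add_eventually {x : N} (v w : TangentSpace (𝓡 m) x) :
    ∀ᶠ y in nhds x, ext (v + w) y = ext v y + ext w y := by
  filter_upwards [triv_mem_nhds (m := m) x] with y hy
  simp [ext_eq_transport hy]

theorem ext_smul_eventually {x : N} (c : ℝ) (v : TangentSpace (𝓡 m) x) :
    ∀ᶠ y in nhds x, ext (c • v) y = c • ext v y := by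
  filter_upwards [triv_mem_nhds (m := m) x] with y hy
  simp [ext_eq_transport hy]

theorem RegOne.dir_ext_lin {θ : Covec m N} (hθ : RegOne θ) {x : N} (u : TangentSpace (𝓡 m) x) :
    IsLinearMap ℝ fun v : TangentSpace (𝓡 m) x => dir (fun y => θ y (ext v y)) x u where
  map_add v w := by
    rw [← dir_add u (hθ.diff x v) (hθ.diff x w)]
    refine dir_congr u ?_
    filter_upwards [ext_add_eventually v w] with y hy
    rw [hy, (hθ.lin y).map_add]
  map_smul c v := by
    rw [smul_eq_mul, ← dir_const_mul u c (hθ.diff x v)]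
    refine dir_congr u ?_
    filter_upwards [ext_smul_eventually c v] with y hy
    rw [hy, (hθ.lin y).map_smul, smul_eq_mul]

theorem RegTwo.dir_ext_left {T : Cov2 m N} (hT : RegTwo T) {x : N}
    (u w : TangentSpace (𝓡 m) x) : IsLinearMap ℝ fun v : TangentSpace (𝓡 m) x =>
      dir (fun y => T y (ext v y) (ext w y)) x u where
  map_add v v' := by
    rw [← dir_add u (hT.diff x v w) (hT.diff x v' w)]
    refine dir_congr u ?_
    filter_upwards [ext_add_eventually v v'] with y hy
    rw [hy, (hT.left y _).map_add]
  map_smul c v := by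
    rw [smul_eq_mul, ← dir_const_mul u c (hT.diff x v w)]
    refine dir_congr u ?_
    filter_upwards [ext_smul_eventually c v] with y hy
    rw [hy, (hT.left y _).map_smul, smul_eq_mul]

theorem RegTwo.dir_ext_right {T : Cov2 m N} (hT : RegTwo T) {x : N}
    (u v : TangentSpace (𝓡 m) x) : IsLinearMap ℝ fun w : TangentSpace (𝓡 m) x =>
      dir (fun y => T y (ext v y) (ext w y)) x u where
  map_add w w' := by
    rw [← dir_add u (hT.diff x v w) (hT.diff x v w')]
    refine dir_congr u ?_
    filter_upwards [ext_add_eventually w w'] with y hy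
    rw [hy, (hT.right y _).map_add]
  map_smul c w := by
    rw [smul_eq_mul, ← dir_const_mul u c (hT.diff x v w)]
    refine dir_congr u ?_
    filter_upwards [ext_smul_eventually c w] with y hy
    rw [hy, (hT.right y _).map_smul, smul_eq_mul]

/-! ### Lie and exterior derivatives in the chart. -/

section Lie

variable {X : VField m N} {θ η : Covec m N} {T S : Cov2 m N} {f : N → ℝ} {x : N}

theorem lieOne_eq (hX : RegVec X) (hθ : RegOne θ) (w : TangentSpace (𝓡 m) x) :
    lieOne X θ x w = dir (fun y => θ y (ext w y)) x (X x) + θ x (coordDer X w) := by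
  rw [lieOne, mlieBracket_ext hX, ← neg_one_smul ℝ, (hθ.lin x).map_smul]
  simp

theorem lieTwo_eq (hX : RegVec X) (hT : RegTwo T) (v w : TangentSpace (𝓡 m) x) :
    lieTwo X T x v w = dir (fun y => T y (ext v y) (ext w y)) x (X x)
      + T x (coordDer X v) w + T x v (coordDer X w) := by
  rw [lieTwo, mlieBracket_ext hX, mlieBracket_ext hX, ← neg_one_smul ℝ (coordDer X v),
    ← neg_one_smul ℝ (coordDer X w), (hT.left x _).map_smul, (hT.right x _).map_smul]
  simp

theorem extDer_eq (hθ : RegOne θ) (v w : TangentSpace (𝓡 m) x) :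
    extDer θ x v w = dir (fun y => θ y (ext w y)) x v - dir (fun y => θ y (ext v y)) x w := by
  rw [extDer, mlieBracket_ext_ext, (hθ.lin x).map_zero, sub_zero]

theorem lieOne_lin (hX : RegVec X) (hθ : RegOne θ) : IsLinearMap ℝ (lieOne X θ x) where
  map_add v w := by
    simp only [lieOne_eq hX hθ, (hθ.dir_ext_lin (X x)).map_add, (coordDer_lin X x).map_add,
      (hθ.lin x).map_add]
    ring
  map_smul c v := by
    simp only [lieOne_eq hX hθ, (hθ.dir_ext_lin (X x)).map_smul, (coordDer_lin X x).map_smul,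
      (hθ.lin x).map_smul, smul_add]

theorem lieTwo_left (hX : RegVec X) (hT : RegTwo T) (w : TangentSpace (𝓡 m) x) :
    IsLinearMap ℝ fun v => lieTwo X T x v w where
  map_add v v' := by
    simp only [lieTwo_eq hX hT, (hT.dir_ext_left (X x) w).map_add, (coordDer_lin X x).map_add,
      (hT.left x _).map_add]
    ring
  map_smul c v := by
    simp only [lieTwo_eq hX hT, (hT.dir_ext_left (X x) w).map_smul, (coordDer_lin X x).map_smul,
      (hT.left x _).map_smul, smul_add]

theorem lieTwo_symm (hX : RegVec X) (hT : RegTwo T) (hs : ∀ y v w, T y v w = T y w v)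
    (v w : TangentSpace (𝓡 m) x) : lieTwo X T x v w = lieTwo X T x w v := by
  rw [lieTwo_eq hX hT, lieTwo_eq hX hT, hs x (coordDer X v), hs x v]
  simp only [hs _ (ext v _) (ext w _)]
  ring

theorem lieTwo_add (hT : RegTwo T) (hS : RegTwo S) (v w : TangentSpace (𝓡 m) x) :
    lieTwo X (fun y a b => T y a b + S y a b) x v w = lieTwo X T x v w + lieTwo X S x v w := by
  simp only [lieTwo]
  rw [dir_add _ (hT.diff x v w) (hS.diff x v w)]
  ring

theorem lieTwo_smul (hf : RegFun m f) (hT : RegTwo T) (v w : TangentSpace (𝓡 m) x) :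
    lieTwo X (fun y a b => f y * T y a b) x v w
      = dir f x (X x) * T x v w + f x * lieTwo X T x v w := by
  simp only [lieTwo]
  rw [dir_mul _ (hf x) (hT.diff x v w), ext_self, ext_self]
  ring

theorem lieTwo_mul (hθ : RegOne θ) (hη : RegOne η) (v w : TangentSpace (𝓡 m) x) :
    lieTwo X (fun y a b => θ y a * η y b) x v w
      = lieOne X θ x v * η x w + θ x v * lieOne X η x w := by
  simp only [lieTwo, lieOne]
  rw [dir_mul _ (hθ.diff x v) (hη.diff x w), ext_self, ext_self]
  ring

/-- Contracting the Lie derivative along `X` of a covector with `θ(X) = c` constant. -/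
theorem RegOne.dir_ext_of_const (hθ : RegOne θ) (hX : RegVec X) {c : ℝ} (h : ∀ y, θ y (X y) = c)
    (v : TangentSpace (𝓡 m) x) :
    dir (fun y => θ y (ext (X x) y)) x v = - θ x (coordDer X v) := by
  have := hθ.dir_contract hX v
  simp only [h, dir_const] at this
  linarith

theorem RegTwo.dir_ext_of_zero (hT : RegTwo T) (hX : RegVec X) (h : ∀ y w, T y (X y) w = 0)
    (v w : TangentSpace (𝓡 m) x) :
    dir (fun y => T y (ext (X x) y) (ext w y)) x v = - T x (coordDer X v) w := by
  have := hT.dir_contract hX v w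
  simp only [h, dir_const] at this
  linarith

theorem lieOne_self (hX : RegVec X) (hθ : RegOne θ) {c : ℝ} (h : ∀ y, θ y (X y) = c) :
    lieOne X θ x (X x) = 0 := by
  rw [lieOne_eq hX hθ, hθ.dir_ext_of_const hX h]
  ring

theorem lieTwo_self (hX : RegVec X) (hT : RegTwo T) (h : ∀ y w, T y (X y) w = 0)
    (w : TangentSpace (𝓡 m) x) : lieTwo X T x (X x) w = 0 := by
  rw [lieTwo_eq hX hT, hT.dir_ext_of_zero hX h, h]
  ring

end Lie

namespace NullMetricData

variable (D : NullMetricData m N) {x : N}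

/-! ### The tensors `U`, `s` and the connection -/

theorem two_mul_U (v w : TangentSpace (𝓡 m) x) : 2 * D.U x v w = lieTwo D.n D.γt x v w := by
  simp [U]

theorem γt_n (y : N) (w : TangentSpace (𝓡 m) y) : D.γt y (D.n y) w = 0 := D.γ_n w

theorem U_symm (v w : TangentSpace (𝓡 m) x) : D.U x v w = D.U x w v := by
  have := lieTwo_symm D.regVec_n D.regTwo_γ D.γ_symm v w
  simp [U, this]

theorem U_n (w : TangentSpace (𝓡 m) x) : D.U x (D.n x) w = 0 := by
  have := lieTwo_self D.regVec_n D.regTwo_γ D.γt_n w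
  simp [U, this]

theorem U_left (w : TangentSpace (𝓡 m) x) : IsLinearMap ℝ fun v => D.U x v w := by
  have h := lieTwo_left D.regVec_n D.regTwo_γ w
  constructor
  · intro v v'
    have := h.map_add v v'
    simp only [← D.two_mul_U] at this
    linarith
  · intro c v
    have := h.map_smul c v
    simp only [← D.two_mul_U, smul_eq_mul] at this ⊢
    linarith

theorem U_right (v : TangentSpace (𝓡 m) x) : IsLinearMap ℝ fun w => D.U x v w := by
  simp only [D.U_symm v]
  exact D.U_left v

/-- Cartan's formula: `d(ℓ(n)) = 0` because `ℓ(n) = 1`, so `£_n ℓ = ι_n dℓ`. -/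
theorem lieOne_ℓ (v : TangentSpace (𝓡 m) x) : lieOne D.n D.ℓt x v = 2 * D.s x v := by
  have h := D.regOne_ℓ.dir_ext_of_const D.regVec_n (fun y => D.ℓ_n (x := y)) v
  rw [lieOne_eq D.regVec_n D.regOne_ℓ]
  simp only [s, F, Pi.smul_apply, smul_eq_mul]
  rw [extDer_eq D.regOne_ℓ, h]
  ring

theorem s_lin : IsLinearMap ℝ (D.s x) := by
  have h := lieOne_lin (x := x) D.regVec_n D.regOne_ℓ
  constructor
  · intro v v'
    have := h.map_add v v'
    simp only [D.lieOne_ℓ] at this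
    linarith
  · intro c v
    have := h.map_smul c v
    simp only [D.lieOne_ℓ, smul_eq_mul] at this ⊢
    linarith

theorem s_n : D.s x (D.n x) = 0 := by
  have := lieOne_self (x := x) D.regVec_n D.regOne_ℓ (fun y => D.ℓ_n (x := y))
  rw [D.lieOne_ℓ] at this
  linarith

theorem koszul_ext (u v w : TangentSpace (𝓡 m) x) :
    D.koszul (ext u) (ext v) (ext w) x =
      dir (fun y => D.γt y (ext v y) (ext w y)) x u + dir (fun y => D.γt y (ext u y) (ext w y)) x v
        - dir (fun y => D.γt y (ext u y) (ext v y)) x w := by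
  simp only [koszul, mlieBracket_ext_ext, ext_self, γt]
  simp

/-- Differentiating `γ(n, ·) = 0` turns two of the derivative terms into derivatives of `n`; with
the third they assemble to `-£_n γ`. -/
theorem koszul_n (v w : TangentSpace (𝓡 m) x) :
    D.koszul (ext v) (ext w) (ext (D.n x)) x = - 2 * D.U x v w := by
  rw [D.koszul_ext, neg_mul, D.two_mul_U, lieTwo_eq D.regVec_n D.regTwo_γ]
  have h := D.regTwo_γ.dir_ext_of_zero D.regVec_n D.γt_n (x := x)
  have hs : ∀ y (a b : TangentSpace (𝓡 m) y), D.γt y a b = D.γt y b a := D.γ_symm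
  simp only [hs _ _ (ext (D.n x) _)]
  rw [h, h, hs x _ v]
  ring

theorem koszul_n_middle (v w : TangentSpace (𝓡 m) x) :
    D.koszul (ext v) (ext (D.n x)) (ext w) x
      = 2 * D.U x v w - 2 * D.γ x (coordDer D.n v) w := by
  rw [D.koszul_ext, D.two_mul_U, lieTwo_eq D.regVec_n D.regTwo_γ]
  have h := D.regTwo_γ.dir_ext_of_zero D.regVec_n D.γt_n (x := x)
  have hs : ∀ y (a b : TangentSpace (𝓡 m) y), D.γt y a b = D.γt y b a := D.γ_symm
  simp only [hs _ _ (ext (D.n x) _)]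
  rw [h, h, hs x _ v]
  simp only [γt]
  ring

theorem koszul_symm (u v w : TangentSpace (𝓡 m) x) :
    D.koszul (ext u) (ext v) (ext w) x = D.koszul (ext v) (ext u) (ext w) x := by
  rw [D.koszul_ext, D.koszul_ext]
  have hs : ∀ y (a b : TangentSpace (𝓡 m) y), D.γt y a b = D.γt y b a := D.γ_symm
  simp only [hs _ (ext u _) (ext v _)]
  ring

theorem koszul_lin (u v : TangentSpace (𝓡 m) x) :
    IsLinearMap ℝ fun w : TangentSpace (𝓡 m) x => D.koszul (ext u) (ext v) (ext w) x where
  map_add w w' := by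
    simp only [D.koszul_ext, dir_vec_add, (D.regTwo_γ.dir_ext_right u v).map_add,
      (D.regTwo_γ.dir_ext_right v u).map_add]
    ring
  map_smul c w := by
    simp only [D.koszul_ext, dir_vec_smul, (D.regTwo_γ.dir_ext_right u v).map_smul,
      (D.regTwo_γ.dir_ext_right v u).map_smul, smul_eq_mul]
    ring

/-- A covector applied to the connection on coordinate fields. -/
theorem apply_nabla_ext {f : TangentSpace (𝓡 m) x → ℝ} (hf : IsLinearMap ℝ f)
    (v w : TangentSpace (𝓡 m) x) :
    f (D.nabla (ext w) x v) =
      (1 / 2) * D.koszul (ext v) (ext w) (ext (D.P x (hf.mk' f))) x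
        + (1 / 2) * (dir (fun y => D.ℓt y (ext w y)) x v + dir (fun y => D.ℓt y (ext v y)) x w)
          * f (D.n x) := by
  rw [nabla, hf.map_add, hf.map_smul, lin_sum hf]
  simp only [mlieBracket_ext_ext, ext_self, map_zero, add_zero, smul_eq_mul]
  congr 1
  have h := D.sum_mul_Pvec hf (D.koszul_lin v w)
  -- Symmetry of `P` moves it from the Koszul functional onto `f`, so the formula can be specialized
  -- to `Pℓ` or `Pθ`.
  have h2 := D.P_symm ((D.koszul_lin v w).mk' _) (hf.mk' f)
  simp only [IsLinearMap.mk'_apply] at h2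
  rw [← h2, ← h, Finset.mul_sum]
  exact Finset.sum_congr rfl fun i _ => by ring

/-- Since `Pℓ = -ℓ⁽²⁾ n`, the Koszul term becomes its value at `n`, a multiple of `U`; the
symmetrized derivatives of `ℓ` cancel. -/
theorem nablaOne_ℓ_symm (v w : TangentSpace (𝓡 m) x) :
    D.nablaOne D.ℓt x v w + D.nablaOne D.ℓt x w v = - 2 * D.ℓ₂ x * D.U x v w := by
  have key : ∀ a b : TangentSpace (𝓡 m) x, D.ℓt x (D.nabla (ext a) x b) = D.ℓ₂ x * D.U x b a
      + (1 / 2) * (dir (fun y => D.ℓt y (ext a y)) x b + dir (fun y => D.ℓt y (ext b y)) x a) := by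
    intro a b
    rw [D.apply_nabla_ext (D.regOne_ℓ.lin x), D.P_ℓ ((D.regOne_ℓ.lin x).mk' _) fun _ => rfl,
      (D.koszul_lin b a).map_smul,
      D.koszul_n]
    simp only [ℓt, D.ℓ_n, smul_eq_mul]
    ring
  simp only [nablaOne, key, D.U_symm w v]
  ring

section Transverse

variable {θ : Covec m N} (hθ : RegOne θ) (hn : ∀ y, θ y (D.n y) = 0)
include hθ hn

/-- As `θ(n) = 0`, the left side is `-θ(∇°_v n)`, and a covector killing `n` sees only the part of
`∇°_v n` given by `U(v, ·)` raised with `P`. -/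
theorem nablaOne_n (v : TangentSpace (𝓡 m) x) :
    D.nablaOne θ x v (D.n x) = - D.U x v (D.P x ((hθ.lin x).mk' _)) := by
  rw [nablaOne, D.apply_nabla_ext (hθ.lin x), D.koszul_n_middle, hn,
    hθ.dir_ext_of_const D.regVec_n hn, D.γ_symm, D.γ_P]
  simp only [IsLinearMap.mk'_apply, hn]
  ring

/-- Torsion-freeness: `(£_n θ)(v) = (∇°_n θ)(v) + θ(∇°_v n)`, and the last term is again `U(v, Pθ)`.
-/
theorem n_nablaOne (v : TangentSpace (𝓡 m) x) :
    D.nablaOne θ x (D.n x) v = lieOne D.n θ x v - D.U x v (D.P x ((hθ.lin x).mk' _)) := by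
  rw [nablaOne, D.apply_nabla_ext (hθ.lin x), D.koszul_symm, D.koszul_n_middle, hn,
    D.γ_symm, D.γ_P, lieOne_eq D.regVec_n hθ]
  simp only [IsLinearMap.mk'_apply, hn]
  ring

end Transverse

theorem nablaOne_add {θ η : Covec m N} (hθ : RegOne θ) (hη : RegOne η)
    (v w : TangentSpace (𝓡 m) x) :
    D.nablaOne (fun y u => θ y u + η y u) x v w = D.nablaOne θ x v w + D.nablaOne η x v w := by
  simp only [nablaOne]
  rw [dir_add v (hθ.diff x w) (hη.diff x w)]
  ring

theorem nablaOne_smul {f : N → ℝ} {θ : Covec m N} (hf : RegFun m f) (hθ : RegOne θ)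
    (v w : TangentSpace (𝓡 m) x) :
    D.nablaOne (fun y u => f y * θ y u) x v w
      = dir f x v * θ x w + f x * D.nablaOne θ x v w := by
  simp only [nablaOne]
  rw [dir_mul v (hf x) (hθ.diff x w), ext_self]
  ring

end NullMetricData

/-! ### The trace of a transported transverse traceless tensor -/

section MatrixTrace

variable {k : Type*} [Fintype k] [DecidableEq k]

open Matrix in
/-- The trace identity behind `tr_P (£_n T) = 2 ⟨U, T⟩`: here `P`, `G`, `Y` are the matrices of `P`,
`γ`, `T`, primes are derivatives along `n`, and `d` is the derivative of `n`. -/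
theorem trace_transport {P G Y P' G' Y' d : Matrix k k ℝ} {n n' l l' : k → ℝ} {c : ℝ}
    (hPG : P * G = 1 - vecMulVec n l) (hP : Pᵀ = P) (hG : Gᵀ = G) (hY : Yᵀ = Y)
    (hYn : Y *ᵥ n = 0) (hPl : P *ᵥ l = c • n)
    (hd : P' * G + P * G' = - vecMulVec n' l - vecMulVec n l')
    (ht : (P' * Y).trace + (P * Y').trace = 0) :
    (P * (Y' + d * Y + Y * dᵀ)).trace = (P * (Y * P * (G' + d * G + G * dᵀ))).trace := by
  -- Because `Y` annihilates `n`, the defect `n ⊗ l` of `PG` from the identity is invisible next to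
  -- `Y`.
  have hnY : n ᵥ* Y = 0 := by rw [← hY, vecMul_transpose, hYn]
  have hYPG : Y * P * G = Y := by
    rw [mul_assoc, hPG, mul_sub, mul_one, mul_vecMulVec, hYn, zero_vecMulVec, sub_zero]
  have hGPY : G * P * Y = Y := by
    have := congrArg transpose hYPG
    simpa only [transpose_mul, hP, hG, hY, mul_assoc] using this
  have hlPY : l ᵥ* (P * Y) = 0 := by
    rw [← vecMul_vecMul, ← hP, vecMul_transpose, hPl, smul_vecMul, hnY, smul_zero]
  have h1 : (P' * Y).trace = - (P * G' * P * Y).trace := by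
    -- Inserting `Y = GPY` lets the derivative of `PG = 1 - n ⊗ l` replace `P'` by `G'`. Both
    -- rank-one terms are then traceless.
    have e : P' * Y = (- vecMulVec n' l - vecMulVec n l' - P * G') * (P * Y) := by
      rw [← hd, add_sub_cancel_right, mul_assoc, ← mul_assoc G, hGPY]
    have h0 : n ⬝ᵥ l' ᵥ* (P * Y) = 0 := by
      rw [dotProduct_comm, ← dotProduct_mulVec, ← mulVec_mulVec, hYn, mulVec_zero, dotProduct_zero]
    rw [e, sub_mul, sub_mul, neg_mul, vecMulVec_mul, hlPY, vecMulVec_mul, trace_sub, trace_sub,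
      trace_neg, trace_vecMulVec, trace_vecMulVec, h0, dotProduct_zero, mul_assoc (P * G')]
    ring
  have h2 : (P * (d * Y)).trace = (P * (Y * P * (d * G))).trace := by
    have e1 : P * (d * Y) = P * d * G * P * Y := by
      conv_lhs => rw [← hGPY]
      simp only [mul_assoc]
    rw [e1, trace_mul_comm, trace_mul_comm P]
    simp only [mul_assoc]
  have h3 : P * (Y * P * (G * dᵀ)) = P * (Y * dᵀ) := by
    rw [← mul_assoc (Y * P), hYPG]
  have h4 : (P * (Y * P * G')).trace = (P * G' * P * Y).trace := by
    rw [mul_assoc (P * G'), trace_mul_comm (P * G')]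
    simp only [mul_assoc]
  simp only [mul_add, trace_add, h3, h2, h4]
  linarith

end MatrixTrace

namespace NullMetricData

variable (D : NullMetricData m N) {x : N}

theorem trAt_eq_sum {B : TangentSpace (𝓡 m) x → TangentSpace (𝓡 m) x → ℝ}
    (hB : ∀ w, IsLinearMap ℝ fun v => B v w) :
    D.trAt x B = ∑ i, ∑ j, D.PComp x i j x * B (tanBasis x j) (tanBasis x i) := by
  show ∑ i, B (D.Pvec x i) (tanBasis x i) = _
  refine Finset.sum_congr rfl fun i _ => ?_
  have h := D.sum_PComp_mul (mem_triv x) (hB (tanBasis x i)) i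
  simp only [frame_self, coframe_self] at h
  exact h.symm

/-- For a symmetric transverse traceless tensor `T`, `tr_P (£_n T) = 2 P^{ac} P^{bd} T_{ab} U_{cd}`. -/
theorem trAt_lieTwo {T : Cov2 m N} (hT : RegTwo T) (hs : ∀ y v w, T y v w = T y w v)
    (hn : ∀ y w, T y (D.n y) w = 0) (htr : ∀ y, D.trP T y = 0) :
    D.trAt x (lieTwo D.n T x) = 2 * D.trAt x (D.contr T D.U x) := by
  let P : Matrix (Fin m) (Fin m) ℝ := .of fun i j => D.PComp x i j x
  let P' : Matrix (Fin m) (Fin m) ℝ := .of fun i j => dir (D.PComp x i j) x (D.n x)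
  let G : Matrix (Fin m) (Fin m) ℝ := .of fun i j => D.γt x (tanBasis x i) (tanBasis x j)
  let G' : Matrix (Fin m) (Fin m) ℝ :=
    .of fun i j => dir (fun y => D.γt y (frame x i y) (frame x j y)) x (D.n x)
  let Y : Matrix (Fin m) (Fin m) ℝ := .of fun i j => T x (tanBasis x i) (tanBasis x j)
  let Y' : Matrix (Fin m) (Fin m) ℝ :=
    .of fun i j => dir (fun y => T y (frame x i y) (frame x j y)) x (D.n x)
  -- Rows index the direction of differentiation and columns the component of `n`; hence `d`
  -- multiplies on the left and its transpose on the right in the Lie derivative.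
  let d : Matrix (Fin m) (Fin m) ℝ :=
    .of fun i j => (tanBasis x).coord j (coordDer D.n (tanBasis x i))
  let n : Fin m → ℝ := fun i => (tanBasis x).coord i (D.n x)
  let n' : Fin m → ℝ := fun i => dir (comp x D.n i) x (D.n x)
  let l : Fin m → ℝ := fun i => D.ℓt x (tanBasis x i)
  let l' : Fin m → ℝ := fun i => dir (fun y => D.ℓt y (frame x i y)) x (D.n x)
  have hlie : ∀ S : Cov2 m N, RegTwo S → ∀ i j, lieTwo D.n S x (tanBasis x i) (tanBasis x j) =
      dir (fun y => S y (frame x i y) (frame x j y)) x (D.n x)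
      + ∑ k, (tanBasis x).coord k (coordDer D.n (tanBasis x i)) * S x (tanBasis x k) (tanBasis x j)
      + ∑ k, (tanBasis x).coord k (coordDer D.n (tanBasis x j))
          * S x (tanBasis x i) (tanBasis x k) := by
    intro S hS i j
    rw [lieTwo_eq D.regVec_n hS, ← lin_sum (hS.left x _), ← lin_sum (hS.right x _)]
    have e : ∀ v : TangentSpace (𝓡 m) x, ∑ k, (tanBasis x).coord k v • tanBasis x k = v :=
      (tanBasis x).sum_repr
    rw [e, e]
    rfl
  have key := trace_transport (P := P) (G := G) (Y := Y) (P' := P') (G' := G') (Y' := Y') (d := d)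
    (n := n) (n' := n') (l := l) (l' := l') (c := - D.ℓ₂ x) ?_ ?_ ?_ ?_ ?_ ?_ ?_ ?_
  · have e1 : D.trAt x (lieTwo D.n T x) = (P * (Y' + d * Y + Y * d.transpose)).trace := by
      rw [D.trAt_eq_sum (lieTwo_left D.regVec_n hT)]
      simp only [hlie T hT, Matrix.trace, Matrix.diag, Matrix.mul_apply, Matrix.add_apply,
        Matrix.transpose_apply]
      refine Finset.sum_congr rfl fun i _ => Finset.sum_congr rfl fun j _ => ?_
      simp only [P, Y', d, Y, Matrix.of_apply]
      congr 2
      exact Finset.sum_congr rfl fun k _ => mul_comm _ _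
    have e2 : 2 * D.trAt x (D.contr T D.U x)
        = (P * (Y * P * (G' + d * G + G * d.transpose))).trace := by
      have hc : ∀ w, IsLinearMap ℝ fun v => D.contr T D.U x v w := fun w => by
        constructor
        · intro v v'
          simp only [contr, (hT.left x _).map_add, add_mul, Finset.sum_add_distrib]
        · intro c v
          simp only [contr, (hT.left x _).map_smul, smul_eq_mul, Finset.mul_sum, mul_assoc]
      rw [D.trAt_eq_sum hc, Finset.mul_sum]
      simp only [Matrix.trace, Matrix.diag]
      refine Finset.sum_congr rfl fun i _ => ?_
      rw [Matrix.mul_apply, Finset.mul_sum]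
      refine Finset.sum_congr rfl fun j _ => ?_
      have h3 : 2 * D.contr T D.U x (tanBasis x j) (tanBasis x i) =
          (Y * P * (G' + d * G + G * d.transpose)) j i := by
        rw [Matrix.mul_apply, contr, Finset.mul_sum]
        refine Finset.sum_congr rfl fun k _ => ?_
        have h4 : T x (tanBasis x j) (D.Pvec x k) = (Y * P) j k := by
          have h := D.sum_PComp_mul (mem_triv x) (hT.right x (tanBasis x j)) k
          simp only [frame_self, coframe_self] at h
          rw [Pvec, ← h, Matrix.mul_apply]
          exact Finset.sum_congr rfl fun a _ => by
            simp only [P, Y, Matrix.of_apply]; rw [D.PComp_symm]; ring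
        have h5 : 2 * D.U x (tanBasis x k) (tanBasis x i)
            = (G' + d * G + G * d.transpose) k i := by
          rw [D.two_mul_U, hlie _ D.regTwo_γ]
          simp only [Matrix.add_apply, Matrix.mul_apply, Matrix.transpose_apply, G', d, G,
            Matrix.of_apply]
          congr 1
          exact Finset.sum_congr rfl fun k _ => mul_comm _ _
        rw [h4, ← h5]
        ring
      rw [← h3]
      simp only [P, Matrix.of_apply]
      ring
    rw [e1, e2, key]
  · ext i j
    have h := D.sum_PComp_γ (mem_triv x) i j
    simp only [frame_self, coframe_self] at h
    simpa [Matrix.mul_apply, Matrix.one_apply, Matrix.vecMulVec_apply, P, G, n, l, γt, ℓt] using h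
  · ext i j
    exact D.PComp_symm _ _ _ _
  · ext i j
    exact D.γ_symm _ _ _
  · ext i j
    exact hs _ _ _
  · ext i
    have h := lin_sum (hT.right x (tanBasis x i)) Finset.univ n (tanBasis x)
    have e : ∑ k, n k • tanBasis x k = D.n x := (tanBasis x).sum_repr (D.n x)
    rw [e, hs, hn] at h
    simp only [Matrix.mulVec, dotProduct, Pi.zero_apply]
    rw [h]
    exact Finset.sum_congr rfl fun k _ => mul_comm _ _
  · ext i
    have h := D.sum_PComp_ℓ (mem_triv x) i
    simp only [frame_self, coframe_self] at h
    exact h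
  -- The identity `Pγ = 1 - n ⊗ ℓ`, valid near `x`, differentiated along `n`.
  · ext i j
    have hev : (fun y => ∑ k, D.PComp x i k y * D.γt y (frame x k y) (frame x j y)) =ᶠ[nhds x]
        fun y => (if i = j then 1 else 0) - comp x D.n i y * D.ℓt y (frame x j y) := by
      filter_upwards [triv_mem_nhds (m := m) x] with y hy
      rw [comp_eq_coframe]
      exact D.sum_PComp_γ hy i j
    have hγ : ∀ k, DiffAt m (fun y => D.γt y (frame x k y) (frame x j y)) x := fun k =>
      D.regTwo_γ.diff x (tanBasis x k) (tanBasis x j)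
    have hℓ : DiffAt m (fun y => D.ℓt y (frame x j y)) x := D.regOne_ℓ.diff x (tanBasis x j)
    have h := dir_congr (D.n x) hev
    rw [dir_sum _ _ fun k _ => (D.diffAt_PComp x i k).mul (hγ k),
      dir_sub _ (diffAt_const _ x) ((D.regVec_n x i).mul hℓ), dir_const,
      dir_mul _ (D.regVec_n x i) hℓ, comp_self, frame_self] at h
    simp only [dir_mul _ (D.diffAt_PComp x i _) (hγ _), frame_self, Finset.sum_add_distrib] at h
    simp only [Matrix.add_apply, Matrix.mul_apply, Matrix.sub_apply, Matrix.neg_apply,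
      Matrix.vecMulVec_apply, P', G, P, G', n', l, n, l', Matrix.of_apply]
    rw [h]
    ring
  -- The identity `tr_P T = 0`, differentiated along `n`.
  · have hev : (fun y => ∑ i, ∑ j, D.PComp x i j y * T y (frame x i y) (frame x j y))
        =ᶠ[nhds x] fun _ => 0 := by
      filter_upwards [triv_mem_nhds (m := m) x] with y hy
      rw [← D.trP_eq_sum hT hy, htr]
    have hd : ∀ i j, DiffAt m (fun y => T y (frame x i y) (frame x j y)) x := fun i j =>
      hT.diff x (tanBasis x i) (tanBasis x j)
    have h := dir_congr (D.n x) hev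
    rw [dir_const, dir_sum _ _ fun i _ => DiffAt.sum _ fun j _ =>
      (D.diffAt_PComp x i j).mul (hd i j)] at h
    simp only [dir_sum _ _ fun j _ => (D.diffAt_PComp x _ j).mul (hd _ j),
      dir_mul _ (D.diffAt_PComp x _ _) (hd _ _), Finset.sum_add_distrib, frame_self] at h
    simp only [Matrix.trace, Matrix.diag, Matrix.mul_apply, P', Y, P, Y', Matrix.of_apply]
    rw [← h]
    congr 1
    · exact Finset.sum_congr rfl fun i _ => Finset.sum_congr rfl fun j _ => by rw [hs]
    · refine Finset.sum_congr rfl fun i _ => Finset.sum_congr rfl fun j _ => ?_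
      simp only [hs _ (frame x i _)]

end NullMetricData

namespace NullMetricData

variable (D : NullMetricData m N) {x : N}

/-! ### The decomposition of a symmetric tensor -/

theorem trAt_swap {B : TangentSpace (𝓡 m) x → TangentSpace (𝓡 m) x → ℝ}
    (hl : ∀ w, IsLinearMap ℝ fun v => B v w) (hr : ∀ v, IsLinearMap ℝ fun w => B v w) :
    D.trAt x (fun v w => B w v) = D.trAt x B := by
  rw [D.trAt_eq_sum hl, D.trAt_eq_sum (B := fun v w => B w v) hr, Finset.sum_comm]
  exact Finset.sum_congr rfl fun i _ => Finset.sum_congr rfl fun j _ => by rw [D.PComp_symm]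

theorem trAt_mul_comm {f g : TangentSpace (𝓡 m) x → ℝ} (hf : IsLinearMap ℝ f)
    (hg : IsLinearMap ℝ g) :
    D.trAt x (fun v w => f v * g w) = D.trAt x (fun v w => g v * f w) := by
  rw [D.trAt_mul hf hg, D.trAt_mul hg hf]
  exact D.P_symm (hg.mk' g) (hf.mk' f)

theorem hat_und (X : VField m N) : D.hat (D.und X) = D.hat X := by
  ext y v
  simp [hat, und, D.γ_n]

/-- The trace part of `bar` is a multiple of `n`, which `γ` kills; lowering what `P` raised only
loses the `n`-component. -/
theorem hat_bar {T : Cov2 m N} (hT : IsLinearMap ℝ (D.iota T x)) (v : TangentSpace (𝓡 m) x) :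
    D.hat (D.bar T) x v = D.iota T x v - D.Q T x * D.ℓ x v := by
  simp only [hat, bar, map_sub, map_smul, sub_apply,
    smul_apply, D.γ_n, D.raise_eq hT, D.γ_P]
  simp [Q, iota]

theorem H_apply {T : Cov2 m N} (hT : IsLinearMap ℝ (D.iota T x)) (v w : TangentSpace (𝓡 m) x) :
    D.H T x v w = T x v w - D.ℓ x v * D.iota T x w - D.iota T x v * D.ℓ x w
      + D.Q T x * D.ℓ x v * D.ℓ x w
      - (D.Q T x * D.ℓ₂ x + D.trP T x) * ((m : ℝ) - 1)⁻¹ * D.γ x v w := by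
  simp only [H, Pi.sub_apply, proj, symProd, D.hat_bar hT, ℓt, C]
  ring

/-- The pressure `- T(n, n)` of a symmetric tensor. -/
def pressure (T : Cov2 m N) : N → ℝ := fun y => - D.Q T y

/-- The energy `- tr_P T` of a symmetric tensor. -/
def energy (T : Cov2 m N) : N → ℝ := fun y => - D.trP T y

/-- The covector `T̄̂`, written as `T(n, ·) - T(n, n) ℓ`. -/
def flux (T : Cov2 m N) : Covec m N := fun y v => D.iota T y v + D.pressure T y * D.ℓt y v

/-- The coefficient of `- γ` in the decomposition of a symmetric tensor. -/
def isotropic (T : Cov2 m N) : N → ℝ := fun y =>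
  ((m : ℝ) - 1)⁻¹ * (D.ℓ₂ y * D.pressure T y + D.energy T y)

section Decomposition

variable {T : Cov2 m N}

theorem regOne_iota (hT : RegTwo T) : RegOne (D.iota T) := hT.contract D.regVec_n

theorem regFun_pressure (hT : RegTwo T) : RegFun m (D.pressure T) := fun x =>
  ((D.regOne_iota hT).contract D.regVec_n x).neg

theorem regFun_energy (hT : RegTwo T) : RegFun m (D.energy T) := fun x => (D.regFun_trP hT x).neg

theorem regFun_isotropic (hT : RegTwo T) : RegFun m (D.isotropic T) := fun x =>
  (((D.regFun_ℓ₂ x).mul (D.regFun_pressure hT x)).add (D.regFun_energy hT x)).const_mul _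

theorem regOne_flux (hT : RegTwo T) : RegOne (D.flux T) :=
  (D.regOne_iota hT).add (D.regOne_ℓ.smul (D.regFun_pressure hT))

theorem flux_n (y : N) : D.flux T y (D.n y) = 0 := by
  simp [flux, pressure, Q, iota, ℓt, D.ℓ_n]

theorem iota_eq (y : N) (v : TangentSpace (𝓡 m) y) :
    D.iota T y v = D.flux T y v + (- D.pressure T y) * D.ℓt y v := by
  simp only [flux]
  ring

/-- The definition of `H` solved for `T`. The signs are those for which `T = ε[Y]` has coefficients
`p`, `μ` and `Ĵ`. -/
theorem decomposition (hT : RegTwo T) (y : N) (v w : TangentSpace (𝓡 m) y) :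
    T y v w = D.ℓt y v * D.flux T y w + D.flux T y v * D.ℓt y w
      + (- D.pressure T y) * (D.ℓt y v * D.ℓt y w) + (- D.isotropic T y) * D.γt y v w
      + D.H T y v w := by
  rw [D.H_apply ((D.regOne_iota hT).lin y)]
  simp only [flux, pressure, isotropic, energy, ℓt, γt]
  ring

theorem regTwo_H (hT : RegTwo T) : RegTwo (D.H T) := by
  have h : D.H T = fun y v w => T y v w + (-1) * (D.ℓt y v * D.flux T y w)
      + (-1) * (D.flux T y v * D.ℓt y w) + D.pressure T y * (D.ℓt y v * D.ℓt y w)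
      + D.isotropic T y * D.γt y v w := by
    funext y v w
    have := D.decomposition hT y v w
    linarith
  have hc : RegFun m (fun _ : N => (-1 : ℝ)) := fun x => diffAt_const _ x
  rw [h]
  exact (((hT.add ((D.regOne_ℓ.mul (D.regOne_flux hT)).smul hc)).add
    (((D.regOne_flux hT).mul D.regOne_ℓ).smul hc)).add
    ((D.regOne_ℓ.mul D.regOne_ℓ).smul (D.regFun_pressure hT))).add
    (D.regTwo_γ.smul (D.regFun_isotropic hT))

theorem H_symm (hT : RegTwo T) (hs : ∀ y v w, T y v w = T y w v) (y : N)
    (v w : TangentSpace (𝓡 m) y) : D.H T y v w = D.H T y w v := by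
  rw [D.H_apply ((D.regOne_iota hT).lin y), D.H_apply ((D.regOne_iota hT).lin y), hs, D.γ_symm]
  ring

theorem H_n (hT : RegTwo T) (y : N) (w : TangentSpace (𝓡 m) y) : D.H T y (D.n y) w = 0 := by
  rw [D.H_apply ((D.regOne_iota hT).lin y), D.γ_n, D.ℓ_n]
  simp only [iota, Q]
  ring

/-- Here `𝒞` is `P`-traceless because `ℓ ⊗ ℓ` has trace `-ℓ⁽²⁾`, and `ℓ ⊗ₛ θ` is because `θ(n) = 0`;
the `γ` term then carries the whole trace. The bound on `m` makes `m - 1` invertible. -/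
theorem trP_H (hm : 2 ≤ m) (hT : RegTwo T) (y : N) : D.trP (D.H T) y = 0 := by
  have hi := (D.regOne_iota hT).lin y
  have h : D.H T y = T y - (fun v w => D.ℓ y v * D.iota T y w)
      - (fun v w => D.iota T y v * D.ℓ y w) + D.Q T y • (fun v w => D.ℓ y v * D.ℓ y w)
      - ((D.Q T y * D.ℓ₂ y + D.trP T y) * ((m : ℝ) - 1)⁻¹) • (fun v w => D.γ y v w) := by
    funext v w
    rw [D.H_apply hi]
    simp [mul_assoc]
  have hm' : (m : ℝ) - 1 ≠ 0 := by
    have : (2 : ℝ) ≤ m := by exact_mod_cast hm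
    linarith
  rw [trP_eq, h]
  simp only [map_sub, map_add, map_smul, D.trAt_ℓ_mul hi, D.trAt_mul_ℓ hi, D.trAt_mul_ℓ D.ℓ_lin,
    D.trAt_γ, smul_eq_mul, D.ℓ_n, ← trP_eq]
  simp only [iota, Q]
  field_simp
  ring

end Decomposition

end NullMetricData

namespace NullMetricData

variable (D : NullMetricData m N) {x : N}

/-! ### The jump of the constraint tensor -/

/-- The jump of the constraint tensor, in terms of the jump `T` and the average `W` of `Y`. -/
def constraintJump (T W : Cov2 m N) : Cov2 m N := fun x v w =>
  - 2 * lieTwo D.n T x v w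
    + 2 * D.Q T x * W x v w + 2 * D.Q W x * T x v w
    - D.trP D.U x * T x v w
    + (D.nablaOne (D.iota T) x v w + D.nablaOne (D.iota T) x w v)
    - 2 * (D.iota T x v * D.iota W x w + D.iota W x v * D.iota T x w)
    + 2 * (D.iota T x v * D.s x w + D.s x v * D.iota T x w)
    - D.trP T x * D.U x v w
    + 2 * (D.contr T D.U x w v + D.contr T D.U x v w)

section Contr

variable {S T : Cov2 m N}

theorem contr_left (hS : ∀ w, IsLinearMap ℝ fun v => S x v w) (w : TangentSpace (𝓡 m) x) :
    IsLinearMap ℝ fun v => D.contr S T x v w where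
  map_add v v' := by simp only [contr, (hS _).map_add, add_mul, Finset.sum_add_distrib]
  map_smul c v := by simp only [contr, (hS _).map_smul, smul_eq_mul, Finset.mul_sum, mul_assoc]

theorem contr_right (hT : ∀ v, IsLinearMap ℝ (T x v)) (v : TangentSpace (𝓡 m) x) :
    IsLinearMap ℝ fun w => D.contr S T x v w where
  map_add w w' := by simp only [contr, (hT _).map_add, mul_add, Finset.sum_add_distrib]
  map_smul c w := by
    simp only [contr, (hT _).map_smul, smul_eq_mul, Finset.mul_sum]
    exact Finset.sum_congr rfl fun i _ => by ring

end Contr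

section Nabla

variable {θ : Covec m N}

theorem nabla_apply_lin (hθ : RegOne θ) (v : TangentSpace (𝓡 m) x) :
    IsLinearMap ℝ fun w => D.nablaOne θ x v w := by
  constructor
  · intro w w'
    simp only [nablaOne, D.apply_nabla_ext (hθ.lin x), D.koszul_ext, (hθ.dir_ext_lin v).map_add,
      (D.regOne_ℓ.dir_ext_lin v).map_add, dir_vec_add, (D.regTwo_γ.dir_ext_left _ _).map_add,
      (D.regTwo_γ.dir_ext_right _ v).map_add]
    ring
  · intro c w
    simp only [nablaOne, D.apply_nabla_ext (hθ.lin x), D.koszul_ext, (hθ.dir_ext_lin v).map_smul,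
      (D.regOne_ℓ.dir_ext_lin v).map_smul, dir_vec_smul, (D.regTwo_γ.dir_ext_left _ _).map_smul,
      (D.regTwo_γ.dir_ext_right _ v).map_smul, smul_eq_mul]
    ring

theorem nabla_dir_lin (hθ : RegOne θ) (w : TangentSpace (𝓡 m) x) :
    IsLinearMap ℝ fun v => D.nablaOne θ x v w := by
  constructor
  · intro v v'
    simp only [nablaOne, D.apply_nabla_ext (hθ.lin x), D.koszul_ext,
      (D.regOne_ℓ.dir_ext_lin w).map_add, dir_vec_add, (D.regTwo_γ.dir_ext_left w _).map_add,
      (D.regTwo_γ.dir_ext_left _ w).map_add]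
    ring
  · intro c v
    simp only [nablaOne, D.apply_nabla_ext (hθ.lin x), D.koszul_ext,
      (D.regOne_ℓ.dir_ext_lin w).map_smul, dir_vec_smul, (D.regTwo_γ.dir_ext_left w _).map_smul,
      (D.regTwo_γ.dir_ext_left _ w).map_smul,
      smul_eq_mul]
    ring

end Nabla

section Formula

variable {T W : Cov2 m N}

theorem lieTwo_decomposition (hT : RegTwo T) (v w : TangentSpace (𝓡 m) x) :
    lieTwo D.n T x v w =
      2 * (D.s x v * D.flux T x w + D.flux T x v * D.s x w)
      + D.ℓ x v * lieOne D.n (D.flux T) x w + lieOne D.n (D.flux T) x v * D.ℓ x w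
      - dir (D.pressure T) x (D.n x) * (D.ℓ x v * D.ℓ x w)
      - 2 * D.pressure T x * (D.s x v * D.ℓ x w + D.ℓ x v * D.s x w)
      - dir (D.isotropic T) x (D.n x) * D.γ x v w
      - 2 * D.isotropic T x * D.U x v w
      + lieTwo D.n (D.H T) x v w := by
  have hθ := D.regOne_flux hT
  have hp : RegFun m fun y => - D.pressure T y := fun y => (D.regFun_pressure hT y).neg
  have hν : RegFun m fun y => - D.isotropic T y := fun y => (D.regFun_isotropic hT y).neg
  have h1 := D.regOne_ℓ.mul hθ
  have h2 := hθ.mul D.regOne_ℓ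
  have h3 := (D.regOne_ℓ.mul D.regOne_ℓ).smul hp
  have h4 := D.regTwo_γ.smul hν
  have e : T = fun y a b => D.ℓt y a * D.flux T y b + D.flux T y a * D.ℓt y b
      + (- D.pressure T y) * (D.ℓt y a * D.ℓt y b) + (- D.isotropic T y) * D.γt y a b
      + D.H T y a b := by
    funext y a b
    exact D.decomposition hT y a b
  conv_lhs => rw [e]
  rw [lieTwo_add (((h1.add h2).add h3).add h4) (D.regTwo_H hT), lieTwo_add ((h1.add h2).add h3) h4,
    lieTwo_add (h1.add h2) h3, lieTwo_add h1 h2, lieTwo_mul D.regOne_ℓ hθ, lieTwo_mul hθ D.regOne_ℓ,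
    lieTwo_smul hp (D.regOne_ℓ.mul D.regOne_ℓ), lieTwo_smul hν D.regTwo_γ,
    lieTwo_mul D.regOne_ℓ D.regOne_ℓ, ← D.two_mul_U, dir_neg, dir_neg]
  simp only [D.lieOne_ℓ, ℓt, γt]
  ring

theorem nablaOne_iota (hT : RegTwo T) (v w : TangentSpace (𝓡 m) x) :
    D.nablaOne (D.iota T) x v w + D.nablaOne (D.iota T) x w v =
      D.nablaOne (D.flux T) x v w + D.nablaOne (D.flux T) x w v
      - dir (D.pressure T) x v * D.ℓ x w - D.ℓ x v * dir (D.pressure T) x w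
      + 2 * D.pressure T x * D.ℓ₂ x * D.U x v w := by
  have hθ := D.regOne_flux hT
  have hp : RegFun m fun y => - D.pressure T y := fun y => (D.regFun_pressure hT y).neg
  have e : D.iota T = fun y a => D.flux T y a + (- D.pressure T y) * D.ℓt y a := by
    funext y a
    exact D.iota_eq y a
  have h := D.nablaOne_ℓ_symm v w
  rw [e, D.nablaOne_add hθ (D.regOne_ℓ.smul hp), D.nablaOne_add hθ (D.regOne_ℓ.smul hp),
    D.nablaOne_smul hp D.regOne_ℓ, D.nablaOne_smul hp D.regOne_ℓ, dir_neg, dir_neg]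
  simp only [ℓt] at h ⊢
  linear_combination - D.pressure T x * h

/-- Since `U` kills `n`, contracting `ℓ` with `U` through `P` gives zero and contracting `γ` gives
back `U`. -/
theorem contr_U (hT : RegTwo T) (v w : TangentSpace (𝓡 m) x) :
    D.contr T D.U x v w = D.ℓ x v * D.U x w (D.raise (D.flux T) x)
      - D.isotropic T x * D.U x v w + D.contr (D.H T) D.U x v w := by
  have hθ := (D.regOne_flux hT).lin x
  have e : D.flux T x (D.P x ((D.U_left w).mk' _)) = D.U x w (D.raise (D.flux T) x) := by
    rw [D.raise_eq hθ, D.U_symm w]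
    exact D.P_symm ((D.U_left w).mk' _) (hθ.mk' _)
  rw [D.contr_eq v w (hT.right x v) (D.U_left w),
    D.contr_eq v w ((D.regTwo_H hT).right x v) (D.U_left w), D.decomposition hT, e]
  simp only [ℓt, γt, D.ℓ_P]
  rw [D.γ_symm, D.γ_P]
  simp only [IsLinearMap.mk'_apply, D.U_n]
  ring

/-- The jump of the constraint tensor in terms of the irreducible parts of the jump of `Y`. -/
theorem constraintJump_eq (hT : RegTwo T) (v w : TangentSpace (𝓡 m) x) :
    D.constraintJump T W x v w =
      - 2 * lieTwo D.n (D.H T) x v w + 2 * (D.contr (D.H T) D.U x v w + D.contr (D.H T) D.U x w v)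
      - 4 * (D.s x v * D.flux T x w + D.flux T x v * D.s x w)
      - 2 * (D.ℓ x v * (lieOne D.n (D.flux T) x w - D.U x w (D.raise (D.flux T) x)
          + dir (D.pressure T) x w / 2)
        + (lieOne D.n (D.flux T) x v - D.U x v (D.raise (D.flux T) x)
          + dir (D.pressure T) x v / 2) * D.ℓ x w)
      + 2 * dir (D.pressure T) x (D.n x) * (D.ℓ x v * D.ℓ x w)
      + 4 * D.pressure T x * (D.s x v * D.ℓ x w + D.ℓ x v * D.s x w)
      + 2 * dir (D.isotropic T) x (D.n x) * D.γ x v w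
      - 2 * D.pressure T x * W x v w
      + (2 * D.Q W x - D.trP D.U x) * (D.ℓ x v * D.flux T x w + D.flux T x v * D.ℓ x w
        - D.pressure T x * (D.ℓ x v * D.ℓ x w) - D.isotropic T x * D.γ x v w + D.H T x v w)
      + (D.nablaOne (D.flux T) x v w + D.nablaOne (D.flux T) x w v)
      - 2 * ((D.flux T x v - D.pressure T x * D.ℓ x v) * D.iota W x w
        + D.iota W x v * (D.flux T x w - D.pressure T x * D.ℓ x w))
      + 2 * ((D.flux T x v - D.pressure T x * D.ℓ x v) * D.s x w
        + D.s x v * (D.flux T x w - D.pressure T x * D.ℓ x w))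
      + (D.energy T x + 2 * D.pressure T x * D.ℓ₂ x) * D.U x v w := by
  have hQ : D.Q T x = - D.pressure T x := by simp [pressure]
  have htr : D.trP T x = - D.energy T x := by simp [energy]
  have hV := D.decomposition hT x v w
  rw [constraintJump, D.lieTwo_decomposition hT, D.nablaOne_iota hT, D.contr_U hT, D.contr_U hT,
    hQ, htr, D.iota_eq (T := T) x v, D.iota_eq (T := T) x w, D.U_symm w v, hV]
  simp only [ℓt, γt]
  ring

/-- The terms in `W` cancel between the two quadratic contributions, so averages are absent here.
The terms `U(w, Pθ)` from `∇°θ` cancel those from the contractions of `T` with `U`. -/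
theorem iota_constraintJump (hT : RegTwo T) (w : TangentSpace (𝓡 m) x) :
    D.iota (D.constraintJump T W) x w =
      - lieOne D.n (D.flux T) x w - D.trP D.U x * D.flux T x w
        - (dir (D.pressure T) x w - dir (D.pressure T) x (D.n x) * D.ℓ x w)
        + 2 * D.pressure T x * D.s x w + D.pressure T x * D.trP D.U x * D.ℓ x w := by
  have hθ := D.regOne_flux hT
  have hθn : ∀ y, D.flux T y (D.n y) = 0 := fun y => D.flux_n y
  have hL := lieTwo_self D.regVec_n (D.regTwo_H hT) (D.H_n hT) w
  have hLn := lieOne_self (x := x) D.regVec_n hθ hθn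
  have hc1 : D.contr (D.H T) D.U x (D.n x) w = 0 := by
    simp [contr, D.H_n hT]
  have hc2 : D.contr (D.H T) D.U x w (D.n x) = 0 := by
    simp [contr, D.U_symm _ (D.n x), D.U_n]
  have hU : D.U x (D.n x) (D.raise (D.flux T) x) = 0 := D.U_n _
  have h1 := D.nablaOne_n hθ hθn w
  have h2 := D.n_nablaOne hθ hθn w
  rw [← D.raise_eq (hθ.lin x)] at h1 h2
  simp only [iota]
  rw [D.constraintJump_eq hT, hL, hLn, hc1, hc2, hU, h1, h2, hθn, D.s_n, D.ℓ_n, D.γ_n, D.U_n,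
    D.H_n hT]
  simp only [iota, Q]
  ring

theorem Q_constraintJump (hT : RegTwo T) :
    D.Q (D.constraintJump T W) x = D.pressure T x * D.trP D.U x := by
  have h := D.iota_constraintJump (W := W) hT (D.n x)
  rw [D.flux_n, D.s_n, D.ℓ_n, lieOne_self D.regVec_n (D.regOne_flux hT) (c := 0)
    fun y => D.flux_n y] at h
  refine h.trans ?_
  ring

theorem dir_isotropic (hT : RegTwo T) (v : TangentSpace (𝓡 m) x) :
    dir (D.isotropic T) x v = ((m : ℝ) - 1)⁻¹ *
      (dir D.ℓ₂ x v * D.pressure T x + D.ℓ₂ x * dir (D.pressure T) x v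
        + dir (D.energy T) x v) := by
  rw [← dir_mul v (D.regFun_ℓ₂ x) (D.regFun_pressure hT x),
    ← dir_add v ((D.regFun_ℓ₂ x).mul (D.regFun_pressure hT x)) (D.regFun_energy hT x),
    ← dir_const_mul v _ (((D.regFun_ℓ₂ x).mul (D.regFun_pressure hT x)).add
      (D.regFun_energy hT x))]
  rfl

omit [IsManifold (𝓡 m) ∞ N] in
theorem dir_lin (f : N → ℝ) : IsLinearMap ℝ fun v : TangentSpace (𝓡 m) x => dir f x v :=
  ⟨dir_vec_add f, dir_vec_smul f⟩

theorem trP_constraintJump (hm : 2 ≤ m) (hT : RegTwo T) (hs : ∀ y v w, T y v w = T y w v)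
    (hW : RegTwo W) :
    D.trP (D.constraintJump T W) x =
      2 * (dir D.ℓ₂ x (D.n x) * D.pressure T x + D.ℓ₂ x * dir (D.pressure T) x (D.n x)
        + dir (D.energy T) x (D.n x))
      + 2 * D.trP (D.nablaOne (D.flux T)) x
      - 4 * D.trAt x (fun v w => D.iota W x v * D.flux T x w)
      - 4 * D.trAt x (fun v w => D.s x v * D.flux T x w)
      - 4 * D.ℓ₂ x * D.Q W x * D.pressure T x
      - 2 * D.Q W x * D.energy T x
      - 2 * D.trP W x * D.pressure T x
      + 2 * D.trP D.U x * (D.ℓ₂ x * D.pressure T x + D.energy T x) := by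
  have hθ := D.regOne_flux hT
  have hθn : ∀ y, D.flux T y (D.n y) = 0 := fun y => D.flux_n y
  have hθl := hθ.lin x
  have hH := D.regTwo_H hT
  have hw := (D.regOne_iota hW).lin x
  have hLl := lieOne_lin (x := x) D.regVec_n hθ
  have hal : IsLinearMap ℝ fun v => D.U x v (D.raise (D.flux T) x) := D.U_left _
  have hdp : IsLinearMap ℝ fun v : TangentSpace (𝓡 m) x => dir (D.pressure T) x v :=
    dir_lin _
  -- The formula is regrouped into pieces with known traces: products with `ℓ` reduce to evaluation
  -- at `n`, and pairs of transposes have equal traces.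
  have e : D.constraintJump T W x =
      (-2 : ℝ) • lieTwo D.n (D.H T) x
      + (2 : ℝ) • (D.contr (D.H T) D.U x + fun v w => D.contr (D.H T) D.U x w v)
      - (2 : ℝ) • ((fun v w => D.s x v * D.flux T x w) + fun v w => D.flux T x v * D.s x w)
      - (2 : ℝ) • ((fun v w => D.ℓ x v * lieOne D.n (D.flux T) x w)
        + fun v w => lieOne D.n (D.flux T) x v * D.ℓ x w)
      + (2 : ℝ) • ((fun v w => D.ℓ x v * D.U x w (D.raise (D.flux T) x))
        + fun v w => D.U x v (D.raise (D.flux T) x) * D.ℓ x w)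
      - ((fun v w => D.ℓ x v * dir (D.pressure T) x w)
        + fun v w => dir (D.pressure T) x v * D.ℓ x w)
      + (2 * dir (D.pressure T) x (D.n x) - (2 * D.Q W x - D.trP D.U x) * D.pressure T x) •
        (fun v w => D.ℓ x v * D.ℓ x w)
      + (2 * D.pressure T x) •
        ((fun v w => D.s x v * D.ℓ x w) + fun v w => D.ℓ x v * D.s x w)
      + (2 * dir (D.isotropic T) x (D.n x) - (2 * D.Q W x - D.trP D.U x) * D.isotropic T x) •
        (fun v w => D.γ x v w)
      - (2 * D.pressure T x) • W x
      + (2 * D.Q W x - D.trP D.U x) • ((fun v w => D.ℓ x v * D.flux T x w)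
        + fun v w => D.flux T x v * D.ℓ x w)
      + (2 * D.Q W x - D.trP D.U x) • D.H T x
      + (D.nablaOne (D.flux T) x + fun v w => D.nablaOne (D.flux T) x w v)
      - (2 : ℝ) • ((fun v w => D.iota W x v * D.flux T x w)
        + fun v w => D.flux T x v * D.iota W x w)
      + (2 * D.pressure T x) • ((fun v w => D.ℓ x v * D.iota W x w)
        + fun v w => D.iota W x v * D.ℓ x w)
      + (D.energy T x + 2 * D.pressure T x * D.ℓ₂ x) • D.U x := by
    funext v w
    rw [D.constraintJump_eq hT]
    simp only [Pi.add_apply, Pi.sub_apply, Pi.smul_apply, smul_eq_mul]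
    ring
  have hm' : (m : ℝ) - 1 ≠ 0 := by
    have : (2 : ℝ) ≤ m := by exact_mod_cast hm
    linarith
  -- The trace of `-2 £_n Υ` exactly cancels that of the two contractions of `Υ` with `U`, so `Υ`
  -- leaves no trace.
  have t1 := D.trAt_lieTwo (x := x) hH (D.H_symm hT hs) (D.H_n hT) (D.trP_H hm hT)
  have t2 := D.trAt_swap (x := x) (B := D.contr (D.H T) D.U x)
    (D.contr_left fun w => hH.left x w) (D.contr_right fun v => D.U_right v)
  have t3 := D.trAt_swap (x := x) (B := D.nablaOne (D.flux T) x)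
    (D.nabla_dir_lin hθ) (D.nabla_apply_lin hθ)
  have t4 : D.trAt x (D.H T x) = 0 := D.trP_H hm hT x
  have hLn := lieOne_self (x := x) D.regVec_n hθ hθn
  have hU : D.U x (D.n x) (D.raise (D.flux T) x) = 0 := D.U_n _
  rw [trP_eq, e]
  simp only [map_add, map_sub, map_smul, smul_eq_mul, t1, t2, t3, t4,
    D.trAt_mul_comm hθl D.s_lin, D.trAt_mul_comm hθl hw, D.trAt_ℓ_mul hLl, D.trAt_mul_ℓ hLl, hLn,
    D.trAt_ℓ_mul hal, D.trAt_mul_ℓ hal, hU, D.trAt_ℓ_mul hdp, D.trAt_mul_ℓ hdp,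
    D.trAt_mul_ℓ D.ℓ_lin, D.ℓ_n, D.trAt_mul_ℓ D.s_lin, D.trAt_ℓ_mul D.s_lin, D.s_n, D.trAt_γ,
    D.trAt_ℓ_mul hθl, D.trAt_mul_ℓ hθl, hθn, D.trAt_ℓ_mul hw, D.trAt_mul_ℓ hw, ← trP_eq]
  rw [D.dir_isotropic hT, isotropic]
  have hwn : D.iota W x (D.n x) = D.Q W x := rfl
  rw [hwn]
  field_simp
  ring

end Formula

end NullMetricData

/-! ### The transverse traceless part of the jump. -/

namespace NullMetricData

variable (D : NullMetricData m N) {x : N}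

section TransverseTraceless

variable {T W : Cov2 m N}

theorem H_of_iota_eq_zero {B : Cov2 m N} (hB : ∀ v : TangentSpace (𝓡 m) x, D.iota B x v = 0)
    (v w : TangentSpace (𝓡 m) x) :
    D.H B x v w = B x v w - D.trP B x * ((m : ℝ) - 1)⁻¹ * D.γ x v w := by
  have hQ : D.Q B x = 0 := hB _
  rw [D.H_apply ⟨fun _ _ => by simp [hB], fun _ _ => by simp [hB]⟩, hB, hB, hQ]
  ring

theorem H_symProd {θ η : Covec m N} (hθ : IsLinearMap ℝ (θ x)) (hη : IsLinearMap ℝ (η x))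
    (hθn : θ x (D.n x) = 0) (hηn : η x (D.n x) = 0) (v w : TangentSpace (𝓡 m) x) :
    D.H (symProd θ η) x v w = (1 / 2) * (θ x v * η x w + η x v * θ x w)
      - D.trAt x (fun v w => θ x v * η x w) * ((m : ℝ) - 1)⁻¹ * D.γ x v w := by
  have e : symProd θ η x = (1 / 2 : ℝ) • ((fun v w => θ x v * η x w) + fun v w => η x v * θ x w) := by
    funext v w
    simp [symProd]
  rw [D.H_of_iota_eq_zero fun v => by simp [iota, symProd, hθn, hηn], trP_eq, e]
  simp only [map_smul, map_add, D.trAt_mul_comm hη hθ, Pi.smul_apply, Pi.add_apply, smul_eq_mul]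
  ring

/-- On a transverse tensor the flux and `Q` vanish, so only the contraction with `U` survives in
`frakB`. -/
theorem lieBar_H (hT : RegTwo T) (v w : TangentSpace (𝓡 m) x) :
    D.lieBar (D.H T) x v w = lieTwo D.n (D.H T) x v w
      - (D.contr (D.H T) D.U x v w + D.contr (D.H T) D.U x w v) := by
  have hi : ∀ v : TangentSpace (𝓡 m) x, D.iota (D.H T) x v = 0 := D.H_n hT x
  have hQ : D.Q (D.H T) x = 0 := hi _
  have hb : ∀ v : TangentSpace (𝓡 m) x, D.hat (D.bar (D.H T)) x v = 0 := fun v => by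
    rw [D.hat_bar ⟨fun _ _ => by simp [hi], fun _ _ => by simp [hi]⟩, hi, hQ]
    ring
  simp only [lieBar, frakB, Pi.add_apply, symProd, hb, hQ]
  ring

/-- With the contraction and the trace already known, removing the projection is pure algebra: terms
containing `ℓ` cancel or are absorbed, and the multiples of `γ` regroup into the trace parts of `O`
and of the individual `H` terms. -/
theorem H_constraintJump (hm : 2 ≤ m) (hT : RegTwo T) (hs : ∀ y v w, T y v w = T y w v)
    (hW : RegTwo W) (v w : TangentSpace (𝓡 m) x) :
    D.H (D.constraintJump T W) x v w =
      - 2 * D.lieBar (D.H T) x v w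
        + D.O (D.flux T) x v w
        - 4 * D.H (symProd (D.hat (D.bar W)) (D.flux T)) x v w
        - 4 * D.H (symProd D.s (D.flux T)) x v w
        + 2 * D.Q W x * D.H T x v w
        - 2 * D.pressure T x * D.H W x v w
        - D.trP D.U x * D.H T x v w
        + (D.energy T x + 2 * D.ℓ₂ x * D.pressure T x) * D.H D.U x v w := by
  have hθ := D.regOne_flux hT
  have hθl := hθ.lin x
  have hθn : D.flux T x (D.n x) = 0 := D.flux_n x
  have hw := (D.regOne_iota hW).lin x
  have hwn : D.iota W x (D.n x) = D.Q W x := rfl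
  have hLl := lieOne_lin (x := x) D.regVec_n hθ
  have hdp : IsLinearMap ℝ fun v : TangentSpace (𝓡 m) x => dir (D.pressure T) x v :=
    dir_lin _
  have hb := D.hat_bar hw
  have hbl : IsLinearMap ℝ (D.hat (D.bar W) x) :=
    ⟨fun _ _ => by simp [hat], fun _ _ => by simp [hat]⟩
  have hbn : D.hat (D.bar W) x (D.n x) = 0 := by
    rw [hb, D.ℓ_n, hwn]
    ring
  have hE : IsLinearMap ℝ (D.iota (D.constraintJump T W) x) := by
    constructor
    · intro a b
      simp only [D.iota_constraintJump hT, hLl.map_add, hθl.map_add, hdp.map_add, D.s_lin.map_add,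
        map_add]
      ring
    · intro c a
      simp only [D.iota_constraintJump hT, hLl.map_smul, hθl.map_smul, hdp.map_smul,
        D.s_lin.map_smul, map_smul, smul_eq_mul]
      ring
  -- The two covectors differ by a multiple of `ℓ`, whose trace against a covector killing `n` is
  -- zero.
  have htr : D.trAt x (fun v w => D.hat (D.bar W) x v * D.flux T x w)
      = D.trAt x (fun v w => D.iota W x v * D.flux T x w) := by
    have e : (fun v w => D.hat (D.bar W) x v * D.flux T x w)
        = (fun v w => D.iota W x v * D.flux T x w)
          - D.Q W x • fun v w => D.ℓ x v * D.flux T x w := by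
      funext v w
      simp only [hb, Pi.sub_apply, Pi.smul_apply, smul_eq_mul]
      ring
    rw [e, map_sub, map_smul, D.trAt_ℓ_mul hθl, hθn]
    simp
  rw [D.H_apply hE, D.iota_constraintJump hT, D.iota_constraintJump hT, D.Q_constraintJump hT,
    D.trP_constraintJump hm hT hs hW, D.constraintJump_eq hT, D.lieBar_H hT,
    D.H_symProd hbl hθl hbn hθn, D.H_symProd D.s_lin hθl D.s_n hθn, D.H_apply hw,
    D.H_of_iota_eq_zero (B := D.U) fun v => D.U_n v, D.dir_isotropic hT, htr, hb, hb, O]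
  simp only [symProd, isotropic, ℓt]
  ring

end TransverseTraceless

/-! ### Jumps and averages -/

section Jump

variable {Y Z : Cov2 m N}

/-- The constraint tensor, as a function of the tensor `Y`. -/
def constraintOf (Y : Cov2 m N) : Cov2 m N := fun x v w =>
  (1 / 2) * (D.ricci x v w + D.ricci x w v)
    - 2 * lieTwo D.n Y x v w
    - (2 * - D.Q Y x + D.trP D.U x) * Y x v w
    + (1 / 2) * (D.nablaOne D.s x v w + D.nablaOne D.s x w v)
    + (D.nablaOne (D.iota Y) x v w + D.nablaOne (D.iota Y) x w v)
    - 2 * D.iota Y x v * D.iota Y x w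
    + 4 * symProd (D.iota Y) D.s x v w
    - D.s x v * D.s x w
    - D.trP Y x * D.U x v w
    + (D.contr ((2 : ℝ) • Y + D.F) D.U x w v + D.contr ((2 : ℝ) • Y + D.F) D.U x v w)

/-- The scaled difference of two tensors. -/
def scaledDiff (c : ℝ) (Y Z : Cov2 m N) : Cov2 m N := fun x v w => c * (Y x v w - Z x v w)

/-- The average of two tensors. -/
def average (Y Z : Cov2 m N) : Cov2 m N := fun x v w => (1 / 2) * (Y x v w + Z x v w)

theorem regTwo_scaledDiff (c : ℝ) (hY : RegTwo Y) (hZ : RegTwo Z) :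
    RegTwo (scaledDiff c Y Z) := by
  have hc : ∀ c : ℝ, RegFun m (fun _ : N => c) := fun c x => diffAt_const c x
  have e : scaledDiff c Y Z = fun x v w => c * (Y x v w + (-1) * Z x v w) := by
    funext x v w
    simp only [scaledDiff]
    ring
  rw [e]
  exact (hY.add (hZ.smul (hc (-1)))).smul (hc c)

theorem regTwo_average (hY : RegTwo Y) (hZ : RegTwo Z) : RegTwo (average Y Z) :=
  (hY.add hZ).smul fun x => diffAt_const (1 / 2) x

theorem trP_scaledDiff (c : ℝ) : D.trP (scaledDiff c Y Z) x = c * (D.trP Y x - D.trP Z x) := by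
  have e : scaledDiff c Y Z x = c • (Y x - Z x) := rfl
  rw [trP_eq, e, map_smul, map_sub]
  rfl

theorem trP_average : D.trP (average Y Z) x = (1 / 2) * (D.trP Y x + D.trP Z x) := by
  have e : average Y Z x = (1 / 2 : ℝ) • (Y x + Z x) := rfl
  rw [trP_eq, e, map_smul, map_add]
  rfl

theorem hat_bar_scaledDiff (c : ℝ) (v : TangentSpace (𝓡 m) x) :
    D.hat (D.bar (scaledDiff c Y Z)) x v = c * (D.hat (D.bar Y) x v - D.hat (D.bar Z) x v) := by
  have e : D.raise (D.iota (scaledDiff c Y Z)) x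
      = c • (D.raise (D.iota Y) x - D.raise (D.iota Z) x) := by
    simp only [raise, iota, scaledDiff, ← Finset.sum_sub_distrib, Finset.smul_sum, ← sub_smul,
      smul_smul]
  simp only [hat, bar, e, map_sub, map_smul, sub_apply, smul_apply, D.γ_n, smul_eq_mul]
  ring

theorem H_scaledDiff (c : ℝ) (v w : TangentSpace (𝓡 m) x) :
    D.H (scaledDiff c Y Z) x v w = c * (D.H Y x v w - D.H Z x v w) := by
  simp only [H, Pi.sub_apply, proj, symProd, D.hat_bar_scaledDiff, D.trP_scaledDiff]
  simp only [Q, scaledDiff]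
  ring

theorem hat_bar_average (v : TangentSpace (𝓡 m) x) :
    D.hat (D.bar (average Y Z)) x v = (1 / 2) * (D.hat (D.bar Y) x v + D.hat (D.bar Z) x v) := by
  have e : D.raise (D.iota (average Y Z)) x
      = (1 / 2 : ℝ) • (D.raise (D.iota Y) x + D.raise (D.iota Z) x) := by
    simp only [raise, iota, average, ← Finset.sum_add_distrib, Finset.smul_sum, ← add_smul,
      smul_smul]
  simp only [hat, bar, e, map_sub, map_add, map_smul, sub_apply, add_apply, smul_apply, D.γ_n,
    smul_eq_mul]
  ring

theorem H_average (v w : TangentSpace (𝓡 m) x) :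
    D.H (average Y Z) x v w = (1 / 2) * (D.H Y x v w + D.H Z x v w) := by
  simp only [H, Pi.sub_apply, proj, symProd, D.hat_bar_average, D.trP_average]
  simp only [Q, average]
  ring

/-- Polarization of a quadratic expression: `a b - a' b'` is difference times average, symmetrized,
and everything depending only on the metric part cancels. -/
theorem scaledDiff_constraintOf (c : ℝ) (hY : RegTwo Y) (hZ : RegTwo Z) :
    scaledDiff c (D.constraintOf Y) (D.constraintOf Z)
      = D.constraintJump (scaledDiff c Y Z) (average Y Z) := by
  funext x v w
  have h1 : lieTwo D.n (scaledDiff c Y Z) x v w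
      = c * (lieTwo D.n Y x v w - lieTwo D.n Z x v w) := by
    simp only [lieTwo, scaledDiff]
    rw [dir_const_mul _ c ((hY.diff x v w).sub (hZ.diff x v w)),
      dir_sub _ (hY.diff x v w) (hZ.diff x v w)]
    ring
  have h2 : ∀ a b : TangentSpace (𝓡 m) x, D.nablaOne (D.iota (scaledDiff c Y Z)) x a b
      = c * (D.nablaOne (D.iota Y) x a b - D.nablaOne (D.iota Z) x a b) := fun a b => by
    have hy := (D.regOne_iota hY).diff x b
    have hz := (D.regOne_iota hZ).diff x b
    have h := dir_const_mul a c (hy.sub hz)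
    rw [dir_sub _ hy hz] at h
    simp only [nablaOne, iota, scaledDiff] at h ⊢
    rw [h]
    ring
  have h3 : ∀ a b : TangentSpace (𝓡 m) x, 2 * D.contr (scaledDiff c Y Z) D.U x a b
      = c * (D.contr ((2 : ℝ) • Y + D.F) D.U x a b - D.contr ((2 : ℝ) • Z + D.F) D.U x a b) := by
    intro a b
    simp only [contr, scaledDiff, Finset.mul_sum, ← Finset.sum_sub_distrib, Pi.add_apply,
      Pi.smul_apply, smul_eq_mul]
    exact Finset.sum_congr rfl fun i _ => by ring
  have h4 := D.trP_scaledDiff (Y := Y) (Z := Z) (x := x) c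
  rw [constraintJump, h1, h2, h2, mul_add 2 (D.contr _ D.U x _ _), h3, h3, h4]
  simp only [scaledDiff, constraintOf, average, iota, Q, symProd]
  ring

theorem flux_eq_hat_bar {T : Cov2 m N} (hT : RegTwo T) : D.flux T = D.hat (D.bar T) := by
  funext y v
  rw [D.hat_bar ((D.regOne_iota hT).lin y)]
  simp only [flux, pressure, ℓt]
  ring

end Jump

end NullMetricData

/-! ### The shell quantities as parts of `ε[Y]` and `⟨Y⟩`. -/

namespace NullShell

variable (S : NullShell m N)

/-- The tensor `Y⁺`. -/
def Ypt : Cov2 m N := fun x v w => S.Yp x v w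

/-- The tensor `Y⁻`. -/
def Ymt : Cov2 m N := fun x v w => S.Ym x v w

/-- The tensor `ε [Y]`. -/
def jumpY : Cov2 m N := NullMetricData.scaledDiff S.ε S.Ypt S.Ymt

/-- The tensor `⟨Y⟩`. -/
def avgY : Cov2 m N := NullMetricData.average S.Ypt S.Ymt

theorem regTwo_jumpY : RegTwo S.jumpY :=
  NullMetricData.regTwo_scaledDiff S.ε S.Yp_smooth.regTwo S.Ym_smooth.regTwo

theorem regTwo_avgY : RegTwo S.avgY :=
  NullMetricData.regTwo_average S.Yp_smooth.regTwo S.Ym_smooth.regTwo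

theorem jumpY_symm (y : N) (v w : TangentSpace (𝓡 m) y) : S.jumpY y v w = S.jumpY y w v := by
  simp only [jumpY, NullMetricData.scaledDiff, Ypt, Ymt, S.Yp_symm y v w, S.Ym_symm y v w]

theorem p_eq : S.p = S.pressure S.jumpY := by
  funext y
  show S.ε * (- S.Yp y (S.n y) (S.n y) - - S.Ym y (S.n y) (S.n y))
    = - (S.ε * (S.Yp y (S.n y) (S.n y) - S.Ym y (S.n y) (S.n y)))
  ring

theorem μ_eq : S.μ = S.energy S.jumpY := by
  funext y
  exact congrArg Neg.neg (S.trP_scaledDiff (Y := S.Ypt) (Z := S.Ymt) S.ε).symm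

/-- Underlining only changes a vector by a multiple of `n`, which disappears on lowering with `γ`.
-/
theorem hat_J_eq : S.hat S.J = S.flux S.jumpY := by
  rw [S.flux_eq_hat_bar S.regTwo_jumpY]
  funext y v
  rw [jumpY, S.hat_bar_scaledDiff]
  have e : ∀ T : Cov2 m N, S.hat (S.bar T) y v = S.γ y (S.und (S.bar T) y) v := fun T => by
    rw [← S.hat_und]
    rfl
  rw [e, e]
  show S.γ y (S.ε • (S.und (S.bar S.Ypt) y - S.und (S.bar S.Ymt) y)) v = _
  simp

theorem Υ_eq : S.Υ = S.H S.jumpY := by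
  funext y v w
  exact (S.H_scaledDiff (Y := S.Ypt) (Z := S.Ymt) S.ε v w).symm

theorem avg_κ_eq (x : N) : S.avg (fun A => A.κ) x = - S.Q S.avgY x := by
  show (1 / 2 : ℝ) * (- S.Yp x (S.n x) (S.n x) + - S.Ym x (S.n x) (S.n x))
    = - ((1 / 2) * (S.Yp x (S.n x) (S.n x) + S.Ym x (S.n x) (S.n x)))
  ring

theorem avg_trP_eq (x : N) : S.avg (fun A => A.trP A.Yt) x = S.trP S.avgY x :=
  (S.trP_average (Y := S.Ypt) (Z := S.Ymt)).symm

theorem avg_hat_bar_eq : S.avg (fun A => A.hat (A.bar A.Yt)) = S.hat (S.bar S.avgY) := by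
  funext x v
  exact (S.hat_bar_average (Y := S.Ypt) (Z := S.Ymt) v).symm

theorem avg_H_eq (x : N) (v w : TangentSpace (𝓡 m) x) :
    S.avg (fun A => A.H A.Yt) x v w = S.H S.avgY x v w :=
  (S.H_average (Y := S.Ypt) (Z := S.Ymt) v w).symm

theorem constraint_eq : NullMetricData.scaledDiff S.ε S.plus.constraint S.minus.constraint
    = S.constraintJump S.jumpY S.avgY :=
  S.scaledDiff_constraintOf S.ε S.Yp_smooth.regTwo S.Ym_smooth.regTwo

theorem jump_ρ_eq (x : N) :
    S.ε * S.jump (fun A => A.ρ) x = S.Q (S.constraintJump S.jumpY S.avgY) x := by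
  rw [← S.constraint_eq]
  rfl

theorem jump_JJ_eq (x : N) (v : TangentSpace (𝓡 m) x) :
    S.ε * S.jump (fun A => A.JJ) x v = S.iota (S.constraintJump S.jumpY S.avgY) x v
      - S.Q (S.constraintJump S.jumpY S.avgY) x * S.ℓ x v := by
  rw [← S.constraint_eq]
  show S.ε * ((S.iota S.plus.constraint x v - S.Q S.plus.constraint x * S.ℓ x v)
    - (S.iota S.minus.constraint x v - S.Q S.minus.constraint x * S.ℓ x v)) = _
  simp only [NullMetricData.iota, NullMetricData.Q, NullMetricData.scaledDiff]
  ring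

theorem jump_pp_eq (x : N) :
    S.ε * S.jump (fun A => A.pp) x = S.trP (S.constraintJump S.jumpY S.avgY) x := by
  rw [← S.constraint_eq, S.trP_scaledDiff]
  rfl

theorem jump_RH_eq (x : N) (v w : TangentSpace (𝓡 m) x) :
    S.ε * S.jump (fun A => A.RH) x v w = S.H (S.constraintJump S.jumpY S.avgY) x v w := by
  rw [← S.constraint_eq, S.H_scaledDiff]
  rfl

end NullShell

end NullShells

end

theorem theorem7p1 {m : ℕ} (hm : 2 ≤ m) {N : Type*} [TopologicalSpace N] [T2Space N]
    [SecondCountableTopology N] [ChartedSpace (EuclideanSpace ℝ (Fin m)) N]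
    [IsManifold (𝓡 m) ∞ N] (S : NullShells.NullShell m N) :
    (∀ x : N, S.ε * S.jump (fun A => A.ρ) x = S.p x * S.trP S.U x) ∧
    (∀ (x : N) (v : TangentSpace (𝓡 m) x),
      S.ε * S.jump (fun A => A.JJ) x v =
        - NullShells.lieOne S.n (S.hat S.J) x v
          - S.trP S.U x * S.hat S.J x v
          - S.DD S.p x v
          + 2 * S.p x * S.s x v) ∧
    (∀ x : N,
      S.ε * S.jump (fun A => A.pp) x =
        2 * NullShells.dir (fun y => S.ℓ₂ y * S.p y + S.μ y) x (S.n x)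
          + 2 * S.trP (S.nablaOne (S.hat S.J)
              - (2 : ℝ) • NullShells.symProd (S.avg fun A => A.hat (A.bar A.Yt)) (S.hat S.J)
              - (2 : ℝ) • NullShells.symProd (S.hat S.J) S.s) x
          + 4 * S.ℓ₂ x * S.avg (fun A => A.κ) x * S.p x
          + 2 * S.avg (fun A => A.κ) x * S.μ x
          - 2 * S.avg (fun A => A.trP A.Yt) x * S.p x
          + 2 * S.trP S.U x * (S.ℓ₂ x * S.p x + S.μ x)) ∧
    (∀ (x : N) (v w : TangentSpace (𝓡 m) x),
      S.ε * S.jump (fun A => A.RH) x v w =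
        - 2 * S.lieBar S.Υ x v w
          + S.O (S.hat S.J) x v w
          - 4 * S.H (NullShells.symProd (S.avg fun A => A.hat (A.bar A.Yt)) (S.hat S.J)) x v w
          - 4 * S.H (NullShells.symProd S.s (S.hat S.J)) x v w
          - 2 * S.avg (fun A => A.κ) x * S.Υ x v w
          - 2 * S.p x * S.avg (fun A => A.H A.Yt) x v w
          - S.trP S.U x * S.Υ x v w
          + (S.μ x + 2 * S.ℓ₂ x * S.p x) * S.H S.U x v w) := by
  have hT := S.regTwo_jumpY
  have hW := S.regTwo_avgY
  refine ⟨fun x => ?_, fun x v => ?_, fun x => ?_, fun x v w => ?_⟩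
  · rw [S.jump_ρ_eq, S.Q_constraintJump hT, S.p_eq]
  · rw [S.jump_JJ_eq, S.iota_constraintJump hT, S.Q_constraintJump hT, S.p_eq, S.hat_J_eq,
      NullShells.NullMetricData.DD]
    ring
  · have hθ := (S.regOne_flux hT).lin x
    have hθn : S.flux S.jumpY x (S.n x) = 0 := S.flux_n x
    have hw := (S.regOne_iota hW).lin x
    -- The stated equation uses `⟨Y̅̂⟩` while the trace formula uses `ι_n⟨Y⟩`; the extra `ℓ ⊗ₛ Ĵ`
    -- term separated here has zero trace.
    have e : (S.nablaOne (S.flux S.jumpY)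
        - (2 : ℝ) • NullShells.symProd (S.hat (S.bar S.avgY)) (S.flux S.jumpY)
        - (2 : ℝ) • NullShells.symProd (S.flux S.jumpY) S.s) x =
        S.nablaOne (S.flux S.jumpY) x
        - ((fun v w => S.iota S.avgY x v * S.flux S.jumpY x w)
          + fun v w => S.flux S.jumpY x v * S.iota S.avgY x w)
        + S.Q S.avgY x • ((fun v w => S.ℓ x v * S.flux S.jumpY x w)
          + fun v w => S.flux S.jumpY x v * S.ℓ x w)
        - ((fun v w => S.s x v * S.flux S.jumpY x w)
          + fun v w => S.flux S.jumpY x v * S.s x w) := by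
      funext v w
      simp only [Pi.sub_apply, Pi.add_apply, Pi.smul_apply, smul_eq_mul, NullShells.symProd,
        S.hat_bar hw]
      ring
    rw [S.jump_pp_eq, S.trP_constraintJump hm hT S.jumpY_symm hW, S.avg_hat_bar_eq, S.avg_κ_eq,
      S.avg_trP_eq, S.p_eq, S.μ_eq, S.hat_J_eq,
      NullShells.dir_add _ ((S.regFun_ℓ₂ x).mul (S.regFun_pressure hT x)) (S.regFun_energy hT x),
      NullShells.dir_mul _ (S.regFun_ℓ₂ x) (S.regFun_pressure hT x), S.trP_eq (_ - _), e]
    simp only [map_add, map_sub, map_smul, smul_eq_mul, S.trAt_mul_comm hθ hw,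
      S.trAt_mul_comm hθ S.s_lin, S.trAt_ℓ_mul hθ, S.trAt_mul_ℓ hθ, hθn, ← S.trP_eq]
    ring
  · rw [S.jump_RH_eq, S.H_constraintJump hm hT S.jumpY_symm hW, S.avg_hat_bar_eq, S.avg_κ_eq,
      S.avg_H_eq, S.p_eq, S.μ_eq, S.hat_J_eq, S.Υ_eq]
    ring
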